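/- **Setting.** Let $\mathcal A=(Q,\Sigma,q_0,\Delta)$ be a $(\min,+)$ weighted automaton with finite $Q$ and $\Sigma$ and exactly one weight in $\mathbb Z\cup\{\infty\}$ for every $(p,\sigma,q)$; a transition is *present* if its weight is finite. Let $\widehat{\mathcal A}$ have states $S=\{(q,p,T): q,p\in T\subseteq Q\}$ (inner state $q$, baseline component $p$, reachable set $T$), initial state $s_0=(q_0,q_0,\{q_0\})$, and as letters the transitions of $\mathcal A$ ($\Gamma_0^0$): on $(q_1,\sigma,c,q_2)$ with $c<\infty$ it has a transition $(p_1,q_1,T_1)\to(p_2,q_2,T_2)$ of weight $c'-c$, where $c'$ is the weight of $(p_1,\sigma,p_2)$ and $T_2$ is the set reached from $T_1$ on $\sigma$; everything else has weight $\infty$. Put $\mathfrak m=|S|\cdot|S|!$. $\mathsf{mwt}(s\xrightarrow{w}r)$ is the least weight of a run on $w$ from $s$ to $r$ ($\infty$ if there is none), and $c_w(q)=\mathsf{mwt}(s_0\xrightarrow{w}q)$. **Cactus letters.** $(S',w)$ is a *stable cycle* if $S'=\{(p,q,T):p\in T\}$ for some $q\in T$, reading $w$ from $S'$ stays in $S'$,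 and for all $n\in\mathbb N$ the state $(q,q,T)$ has $\mathsf{mwt}$ of its cycle on $w^n$ equal to $0$ and least among all $s\in S'$ with a cycle on $w^n$. $(s,r)\in S'\times S'$ is *grounded* if $s\xrightarrow{w^{\mathfrak m}}g\xrightarrow{w^{\mathfrak m}}r$ for some $g\in S'$ with a cycle of least weight on $w^{\mathfrak m}$. The letter $\alpha_{S',w}$ has, for every grounded pair, a transition $s\to r$ whose weight is the least $\mathsf{mwt}(s\xrightarrow{w^{\mathfrak m}}g\xrightarrow{w^{\mathfrak m}}r)$ over such $g$. $(S',w)$ is *degenerate* if $(s,t)$ is grounded whenever $s,t\in S'$, $t$ has a cycle on $w^{2\mathfrak m}$, and $t$ is reachable from $s$ on $w^{2\mathfrak mk}$ for some $k\ge1$. For a grounded pair $s=(q_1,p,T)$, $r=(q_2,p,T)$ with $\alpha_{S',w}$-weight $c$, the *rebase letter* $\beta_{S',w,s\to r}$ has the transitions $(q',q_1,T)\to(q'',q_2,T)$ of weight $d-c$, for every $\alpha_{S',w}$-transition $(q',p,T)\to(q'',p,T)$ of weight $d$. For $p_1,p_2\in T$ the *jump letter* has the transitions $(q',p_1,T)\to(q',p_2,T)$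 of weight $0$. Depth: $0$ for letters of $\Gamma_0^0$, $1+\mathsf{dep}(w)$ for $\alpha_{S',w}$ and $\beta_{S',w,s\to r}$, the maximum over the letters for a word, and $0$ for the empty word. For $L:\mathbb N\to\mathbb N$ let $\Upsilon_L$ be the smallest set containing $\Gamma_0^0$ and every $\alpha_{S',w}$ with $w\in\Upsilon_L^*$, $(S',w)$ stable and non-degenerate, $\mathsf{dep}(w)+1\le|S|-1$ and $|w|\le L(\mathsf{dep}(w)+1)$. $\Upsilon_L^{\mathrm{reb}}$ adds the rebase letters of the cactus letters in $\Upsilon_L$, and $\Upsilon_L^{\mathrm{jump}}$ adds all jump letters to this. $\Upsilon_L^{\mathrm{cac}}$ is the set of all $\alpha_{S',w}$ with $w\in(\Upsilon_L^{\mathrm{reb}})^*$, $(S',w)$ stable and $|w|\le L(\mathsf{dep}(w)+1)$. **Constants.** Let $\mathsf{Ramsey}(k,n)$ be the least $R$ such that every $k$-colouring of the pairs from $\{1,\dots,R\}$ is constant on the pairs of some set of at least $n$ elements. For $h\in\mathbb N$ and $i_0\in\{0,1\}$ define, with $W_0$ the largest absolute value of a finite weight of $\widehat{\mathcal A}$ over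 $\Gamma_0^0$: - $\mathrm{Len}(0,i)=1$, $\mathrm{Len}(d,|S|+1)=1$ and, for $i\le|S|$, $\mathrm{Len}(d+1,i)=32\mathfrak m^2\,\mathrm{Len}(d,1)\,\mathrm{Len}(d+1,i+1)\,(\mathsf{Ramsey}(\mathrm{Typ}(d+1,i),3)+2)^{2\mathrm{Amp}(d+1,i)+1}$; - $\mathrm{Cov}(d,|S|)=1$ and, for $i<|S|$, $\mathrm{Cov}(d+1,i)=8\mathfrak m^2(\mathrm{MaxW}(d)\,\mathrm{Len}(d,1)\,\mathrm{Len}(d+1,i+1)+\mathrm{Cov}(d+1,i+1)+h)$; - $\mathrm{MaxW}(0)=W_0$ and $\mathrm{MaxW}(d+1)=2\mathfrak m\,\mathrm{MaxW}(d)\,\mathrm{Len}(d+1,i_0)$; - $\mathrm{Amp}(d+1,i)=32\mathfrak m^2(h+2\,\mathrm{MaxW}(d))(\mathsf{Ramsey}(\mathrm{Typ}(d+1,i),3)+\mathrm{Len}(d+1,i+1)+\mathrm{Len}(d,1))$; - $\mathrm{Typ}(d+1,i)=3^i(2\,\mathrm{Cov}(d+1,i)+2)^{2|S|i}$. The *simple*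 functions are those with $h=0$, $i_0=1$; put $L_{\mathsf{simp}}(d)=\mathrm{Len}(d,1)$ and $\mathbf H=\mathrm{Amp}(|S|,0)$ for them. The *general* functions are those with $h=\mathbf H$, $i_0=0$; write $\mathrm{GLen}$ for their $\mathrm{Len}$, and $L_{\mathsf{gen}}(d)=\mathrm{GLen}(d,1)$. **Potential and charge.** A word $w$ *has a seamless baseline run* if there is a run on $w$ from $s_0$ through states of the form $(p,p,T)$ only, each prefix of which has the least weight among all runs from $s_0$ on the same prefix of $w$ to the same state. For such $w$, a state $q$ with $c_w(q)<\infty$ is *dominant* if some $z\in(\Upsilon_{L_{\mathsf{simp}}}^{\mathrm{jump}})^*\cdot\Upsilon_{L_{\mathsf{gen}}}^{\mathrm{cac}}$ can be read from $q$ with finite weight but not from any $p$ with $c_w(p)<c_w(q)$. The potential $\phi(w)$ is the largest $c_w(q)$ over dominant $q$, and the charge is $\psi(w)=-\min_q c_w(q)$. **General SRI.** Let $\mathsf{maxeff}(w)$ be the sum over the letters of $w$ of the largest absolute value of a finite transition weight on the letter. A word $uxyv\in\Upsilon_{L_{\mathsf{gen}}}^*$ with $x,y$ non-empty is a *general SRI*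 if (1) $c_u,c_{ux},c_{uxy}$ are finite on the same set $B$ of states; (2) $|x|\le\frac1{\mathfrak m}L_{\mathsf{gen}}(\mathsf{dep}(x)+1)$; (3) $B$ is partitioned into non-empty sets $V_1,\dots,V_\ell$ such that $c_\xi(s')-c_\xi(s)>4|S|\mathfrak m\,\mathsf{maxeff}(xy)+\mathbf H$ for all $j<\ell$, $s\in V_j$, $s'\in V_{j+1}$, $\xi\in\{u,ux,uxy\}$, and for every $j$ there are integers $k_{j,x},k_{j,y}$ of the same sign ($-$, $0$ or $+$) with $c_{ux}(s)=c_u(s)+k_{j,x}$ and $c_{uxy}(s)=c_{ux}(s)+k_{j,y}$ for all $s\in V_j$; (4) $uxyv$ has a seamless baseline run; (5) $\psi(u)\ge\psi(ux)\ge\psi(uxy)$, and $\psi(u)=\psi(ux)$ iff $\psi(ux)=\psi(uxy)$. **Statement.** At least one of the following holds. 1. There is a word $w'\in(\Gamma_0^0)^*$ that has a seamless baseline run and $\phi(w')>\mathbf H$. 2. For all $w_1,w_2,w_3\in\Upsilon_{L_{\mathsf{gen}}}^*$ such that $w_1w_2w_3$ has a seamless baseline run, $\psi(w_1)\ge\psi(w_1w_2)$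 and $|w_2|=\frac{1}{32\mathfrak m^2}\mathrm{GLen}(|S|,1)$, there is a decomposition $w_1w_2w_3=uxyv$ that is a general SRI in which $xy$ is an infix of $w_2$ (that is, $u=w_1p$, $w_2=pxys$ and $v=sw_3$ for some words $p,s$). -/

import Mathlib

noncomputable section

namespace TropWFA

open Finset

universe u v

/-- A weighted automaton over the tropical semiring with a single initial state; the weight of the
unique transition from `p` to `q` on `a` is `wt p a q`, and `⊤` stands for `∞`. -/
structure WFA (Q : Type u) (Sig : Type v) where
  init : Q
  wt : Q → Sig → Q → WithTop ℤ

/-! ### States and letters of the baseline-augmented automaton and of its cactus extension -/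

/-- The states `(q, p, T)` with `q, p ∈ T`. -/
abbrev State (Q : Type u) [DecidableEq Q] : Type u :=
  {s : Q × Q × Finset Q // s.1 ∈ s.2.2 ∧ s.2.1 ∈ s.2.2}

/-- The inner state `q` of `(q, p, T)`. -/
def inner {Q : Type u} [DecidableEq Q] (s : State Q) : Q := s.1.1

/-- The baseline component `p` of `(q, p, T)`. -/
def base {Q : Type u} [DecidableEq Q] (s : State Q) : Q := s.1.2.1

/-- The reachable subset `T` of `(q, p, T)`. -/
def reach {Q : Type u} [DecidableEq Q] (s : State Q) : Finset Q := s.1.2.2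

theorem inner_mem {Q : Type u} [DecidableEq Q] (s : State Q) : inner s ∈ reach s := s.2.1

theorem base_mem {Q : Type u} [DecidableEq Q] (s : State Q) : base s ∈ reach s := s.2.2

/-- A baseline state `(p, p, T)`. -/
def IsBaseline {Q : Type u} [DecidableEq Q] (s : State Q) : Prop := inner s = base s

/-- Raw letters.  `std p a q` is the transition of the original automaton from `p` to `q` on `a`
(its weight is determined by the automaton), `cactus S' w` is `α_{S',w}`, `rebase S' w s r` is
`β_{S',w,s→r}`, and `jump p₁ p₂ T` is the jump letter from `(·, p₁, T)` to `(·, p₂, T)`.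
Which raw letters are admitted is said by the alphabets below. -/
inductive Letter (Q : Type u) (Sig : Type v) [DecidableEq Q] : Type (max u v)
  | std (p : Q) (a : Sig) (q : Q) : Letter Q Sig
  | cactus (S' : Finset (State Q)) (w : List (Letter Q Sig)) : Letter Q Sig
  | rebase (S' : Finset (State Q)) (w : List (Letter Q Sig)) (s r : State Q) : Letter Q Sig
  | jump (p₁ p₂ : Q) (T : Finset Q) : Letter Q Sig

mutual
/-- The depth of a letter. -/
def letterDepth {Q : Type u} {Sig : Type v} [DecidableEq Q] : Letter Q Sig → ℕ
  | .std _ _ _ => 0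
  | .cactus _ w => 1 + depth w
  | .rebase _ w _ _ => 1 + depth w
  | .jump _ _ _ => 0
/-- The depth of a word: the maximal depth of its letters (`0` for the empty word). -/
def depth {Q : Type u} {Sig : Type v} [DecidableEq Q] : List (Letter Q Sig) → ℕ
  | [] => 0
  | σ :: w => max (letterDepth σ) (depth w)
end

/-- The stabilisation constant `|S| · |S|!` for a state space of size `N = |S|`. -/
def stabConst (N : ℕ) : ℕ := N * N.factorial

/-! ### Reflexive and stable cycles, grounded pairs

The behaviour of a word `w` is the matrix `M s r = mwt(s →w→ r)`; the behaviour of `w ^ n` is the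
power `mpow M n` (see `mwt_pow` below).  All notions about `(S', w)` depend on `w` only through its
behaviour, and `M s r ≠ ⊤` says that there is a run on `w` from `s` to `r`. -/

section Cycles

variable {Q : Type u} [DecidableEq Q] [Fintype Q]

/-- Powers of a behaviour for the (min,+) matrix product. -/
def mpow (M : State Q → State Q → WithTop ℤ) : ℕ → State Q → State Q → WithTop ℤ
  | 0 => fun s r => if s = r then 0 else ⊤
  | n + 1 => fun s r => univ.inf fun t => M s t + mpow M n t r

/-- `S' = {(p, q, T) | p ∈ T}`, where `b = (q, q, T)` is the baseline state of `S'`. -/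
def IsSaturated (S' : Finset (State Q)) (b : State Q) : Prop :=
  IsBaseline b ∧ ∀ s : State Q, s ∈ S' ↔ base s = base b ∧ reach s = reach b

/-- A reflexive cycle with baseline state `b`: `S'` is saturated and closed under reading the
word. -/
def IsReflexiveCycle (S' : Finset (State Q)) (b : State Q)
    (M : State Q → State Q → WithTop ℤ) : Prop :=
  IsSaturated S' b ∧ ∀ s ∈ S', ∀ r, M s r ≠ ⊤ → r ∈ S'

open Classical in
/-- The reflexive states. -/
def refStates (S' : Finset (State Q)) (M : State Q → State Q → WithTop ℤ) : Finset (State Q) :=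
  S'.filter fun s => M s s ≠ ⊤

open Classical in
/-- The minimal reflexive states. -/
def minStates (S' : Finset (State Q)) (M : State Q → State Q → WithTop ℤ) : Finset (State Q) :=
  (refStates S' M).filter fun s => ∀ r ∈ refStates S' M, M s s ≤ M r r

/-- Stable cycles: for every `n`, the baseline state is minimal reflexive on `w ^ n` and its minimal
cycle on `w ^ n` has weight `0`. -/
def IsStableCycle (S' : Finset (State Q)) (M : State Q → State Q → WithTop ℤ) : Prop :=
  ∃ b : State Q, IsReflexiveCycle S' b M ∧
    ∀ n : ℕ, b ∈ minStates S' (mpow M n) ∧ mpow M n b b = 0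

/-- `(s, r)` is a grounded pair, with `m` the stabilisation constant. -/
def IsGrounded (S' : Finset (State Q)) (M : State Q → State Q → WithTop ℤ) (s r : State Q) :
    Prop :=
  s ∈ S' ∧ r ∈ S' ∧
    ∃ g ∈ minStates S' (mpow M (stabConst (Fintype.card (State Q)))),
      mpow M (stabConst (Fintype.card (State Q))) s g ≠ ⊤ ∧
      mpow M (stabConst (Fintype.card (State Q))) g r ≠ ⊤

open Classical in
/-- The weight of the transition from `s` to `r` on `α_{S',w}`: for a grounded pair it is the weight
`mwt(s →w^m→ g →w^m→ r)` through a grounding state `g`, that is, a minimal reflexive state for `w^m`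
where this weight is least; all other transitions have weight `∞`. -/
def stabWt (S' : Finset (State Q)) (M : State Q → State Q → WithTop ℤ) (s r : State Q) :
    WithTop ℤ :=
  if IsGrounded S' M s r then
    (minStates S' (mpow M (stabConst (Fintype.card (State Q))))).inf fun g =>
      mpow M (stabConst (Fintype.card (State Q))) s g +
        mpow M (stabConst (Fintype.card (State Q))) g r
  else ⊤

/-- Degenerate cycles: every `t` that is reflexive on `w^{2m}` and that can be reached from
`s ∈ S'` on some `w^{2mk}`, `k ≥ 1`, is grounded with `s`. -/
def IsDegenerate (S' : Finset (State Q)) (M : State Q → State Q → WithTop ℤ) : Prop :=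
  ∀ s ∈ S', ∀ t ∈ refStates S' (mpow M (2 * stabConst (Fintype.card (State Q)))),
    (∃ k : ℕ, 1 ≤ k ∧ mpow M (2 * stabConst (Fintype.card (State Q)) * k) s t ≠ ⊤) →
      IsGrounded S' M s t

/-- The transitions on `β_{S',w,s→r}`, given the transitions `D` on `α_{S',w}`: with
`s = (q₁, p, T)` and `r = (q₂, p, T)`, the transition from `(q', q₁, T)` to `(q'', q₂, T)` has weight
`D (q', p, T) (q'', p, T) - D s r`. -/
def rebaseWt (D : State Q → State Q → WithTop ℤ) (s r t t' : State Q) : WithTop ℤ :=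
  if h : (base t = inner s ∧ reach t = reach s) ∧ (base t' = inner r ∧ reach t' = reach r) then
    D ⟨(inner t, base s, reach s), h.1.2 ▸ inner_mem t, base_mem s⟩
      ⟨(inner t', base r, reach r), h.2.2 ▸ inner_mem t', base_mem r⟩ +
    (D s r).map fun c => -c
  else ⊤

end Cycles

/-! ### Transitions, runs and configurations -/

section Weights

variable {Q : Type u} {Sig : Type v} [DecidableEq Q] [Fintype Q] (A : WFA Q Sig)

open Classical in
/-- The states of `A` that are reachable from `T` by reading `a`. -/
def succ (T : Finset Q) (a : Sig) : Finset Q :=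
  univ.filter fun q => ∃ p ∈ T, A.wt p a q ≠ ⊤

/-- The initial state `(q₀, q₀, {q₀})`. -/
def init : State Q := ⟨(A.init, A.init, {A.init}), by simp⟩

open Classical in
mutual
/-- The weight of the transition between two states on a letter. For a standard letter
`(q₁, σ, c, q₂)` with `c ≠ ∞` the transition from `(p₁, q₁, T₁)` to `(p₂, q₂, T₂)`, where `T₂` is
reached from `T₁` on `σ`, has weight `c' - c`, with `c'` the weight from `p₁` to `p₂` on `σ`. -/
def letterWt : Letter Q Sig → State Q → State Q → WithTop ℤ
  | .std p a q => fun s r =>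
      if base s = p ∧ base r = q ∧ reach r = succ A (reach s) a then
        A.wt (inner s) a (inner r) + (A.wt p a q).map fun c => -c
      else ⊤
  | .cactus S' w => stabWt S' (mwt w)
  | .rebase S' w s r => rebaseWt (stabWt S' (mwt w)) s r
  | .jump p₁ p₂ T => fun s r =>
      if base s = p₁ ∧ reach s = T ∧ base r = p₂ ∧ reach r = T ∧ inner r = inner s then 0 else ⊤
/-- `mwt A w s r` is the minimal weight of a run on `w` from `s` to `r`; see `mwt_le_runWt` and
`exists_runWt_eq_mwt`. -/
def mwt : List (Letter Q Sig) → State Q → State Q → WithTop ℤ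
  | [] => fun s r => if s = r then 0 else ⊤
  | σ :: w => fun s r => univ.inf fun t => letterWt σ s t + mwt w t r
end

/-- The weight of the sequence of transitions on `w` through the states `ρ 0, ρ 1, …, ρ |w|`; it is
a run if this weight is finite. -/
def runWt : List (Letter Q Sig) → (ℕ → State Q) → WithTop ℤ
  | [], _ => 0
  | σ :: w, ρ => letterWt A σ (ρ 0) (ρ 1) + runWt w fun i => ρ (i + 1)

theorem mwt_le_runWt (w : List (Letter Q Sig)) (ρ : ℕ → State Q) :
    mwt A w (ρ 0) (ρ w.length) ≤ runWt A w ρ := by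
  induction w generalizing ρ with
  | nil => simp [mwt, runWt]
  | cons σ w ih =>
    simp only [mwt, runWt, List.length_cons]
    exact (Finset.inf_le (mem_univ (ρ 1))).trans
      (add_le_add le_rfl (ih fun i => ρ (i + 1)))

theorem exists_runWt_eq_mwt (w : List (Letter Q Sig)) (s r : State Q) (h : mwt A w s r ≠ ⊤) :
    ∃ ρ : ℕ → State Q, ρ 0 = s ∧ ρ w.length = r ∧ runWt A w ρ = mwt A w s r := by
  induction w generalizing s with
  | nil =>
    have hsr : s = r := by
      by_contra hne
      exact h (by simp [mwt, hne])
    exact ⟨fun _ => s, rfl, hsr, by simp [runWt, mwt, hsr]⟩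
  | cons σ w ih =>
    obtain ⟨t, -, ht⟩ := Finset.exists_mem_eq_inf (univ : Finset (State Q)) ⟨s, mem_univ s⟩
      fun t => letterWt A σ s t + mwt A w t r
    have hm : mwt A (σ :: w) s r = letterWt A σ s t + mwt A w t r := by
      simp only [mwt]; exact ht
    obtain ⟨ρ, h0, h1, h2⟩ := ih t (by
      intro htop
      exact h (by rw [hm, htop, add_top]))
    refine ⟨fun i => Nat.casesOn i s ρ, rfl, by simpa using h1, ?_⟩
    rw [hm]
    change letterWt A σ s (ρ 0) + runWt A w ρ = _
    rw [h0, h2]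

theorem mwt_append (w w' : List (Letter Q Sig)) (s r : State Q) :
    mwt A (w ++ w') s r = univ.inf fun t => mwt A w s t + mwt A w' t r := by
  apply le_antisymm
  · refine Finset.le_inf fun t _ => ?_
    induction w generalizing s with
    | nil =>
      by_cases hst : s = t
      · subst hst; simp [mwt]
      · simp [mwt, hst]
    | cons σ w ih =>
      by_cases htop : mwt A (σ :: w) s t = ⊤
      · simp [htop]
      · obtain ⟨x, -, hx⟩ := Finset.exists_mem_eq_inf (univ : Finset (State Q)) ⟨s, mem_univ s⟩
          fun x => letterWt A σ s x + mwt A w x t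
        have hm : mwt A (σ :: w) s t = letterWt A σ s x + mwt A w x t := by
          simp only [mwt]; exact hx
        rw [hm, add_assoc]
        simp only [mwt, List.cons_append]
        exact (Finset.inf_le (mem_univ x)).trans (add_le_add le_rfl (ih x))
  · induction w generalizing s with
    | nil =>
      refine (Finset.inf_le (mem_univ s)).trans ?_
      simp [mwt]
    | cons σ w ih =>
      simp only [List.cons_append]
      conv_rhs => rw [mwt]
      refine Finset.le_inf fun x _ => ?_
      obtain ⟨t, -, ht⟩ := Finset.exists_mem_eq_inf (univ : Finset (State Q)) ⟨s, mem_univ s⟩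
        fun t => mwt A w x t + mwt A w' t r
      refine le_trans ?_ (add_le_add (le_refl (letterWt A σ s x)) (ih x))
      rw [ht, ← add_assoc]
      refine (Finset.inf_le (mem_univ t)).trans (add_le_add ?_ le_rfl)
      simp only [mwt]
      exact Finset.inf_le (mem_univ x)

/-- The behaviour of `w ^ n` is the `n`-th power of the behaviour of `w`. -/
theorem mwt_pow (w : List (Letter Q Sig)) (n : ℕ) (s r : State Q) :
    mwt A (List.replicate n w).flatten s r = mpow (mwt A w) n s r := by
  induction n generalizing s with
  | zero => simp [mwt, mpow]
  | succ n ih =>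
    rw [List.replicate_succ, List.flatten_cons, mwt_append]
    simp only [mpow, ih]

/-- The configuration reached from the initial state by reading `w`. -/
def xconf (w : List (Letter Q Sig)) : State Q → WithTop ℤ := fun q => mwt A w (init A) q

/-- The support of a configuration. -/
def supp (c : State Q → WithTop ℤ) : Set (State Q) := {q | c q ≠ ⊤}

/-- There is a run on `w` from the initial state that visits only baseline states and that is
seamless: each of its prefixes has minimal weight among the runs from the initial state to the state
it reaches. -/
def HasSeamlessBaseline (w : List (Letter Q Sig)) : Prop :=
  ∃ ρ : ℕ → State Q, ρ 0 = init A ∧ runWt A w ρ ≠ ⊤ ∧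
    (∀ j ≤ w.length, IsBaseline (ρ j)) ∧
    ∀ j ≤ w.length, runWt A (w.take j) ρ = mwt A (w.take j) (init A) (ρ j)

/-- The maximal absolute value of a finite weight of a transition on `σ`. -/
def maxWt (σ : Letter Q Sig) : ℕ :=
  univ.sup fun s : State Q => univ.sup fun r : State Q => ((letterWt A σ s r).untopD 0).natAbs

/-- The maximal effect of a word. -/
def maxEff (w : List (Letter Q Sig)) : ℕ := (w.map (maxWt A)).sum

end Weights

/-! ### The recursive length functions -/

/-- The least `R` such that every colouring of the 2-element subsets of an `R`-element set with `k`
colours is constant on the 2-element subsets of some set of size at least `n`. -/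
def Ramsey (k n : ℕ) : ℕ :=
  sInf {R : ℕ | ∀ c : {e : Finset (Fin R) // e.card = 2} → Fin k,
    ∃ V : Finset (Fin R), n ≤ V.card ∧ ∀ e e', e.1 ⊆ V → e'.1 ⊆ V → c e = c e'}

section Lengths

/- `N` is the number of states, `W` the maximal weight of a standard letter, `H` the additive
constant, and `i₀` the second argument of `lenF` in the recursion of `maxF`. -/
variable (N W H i₀ : ℕ)

mutual
/-- `Len(d, i)`, for `i ≤ N + 1`. -/
def lenF : ℕ → ℕ → ℕ
  | 0, _ => 1
  | d + 1, i =>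
    if i ≤ N then
      32 * stabConst N ^ 2 * lenF d 1 * lenF (d + 1) (i + 1) *
        (Ramsey (typF (d + 1) i) 3 + 2) ^ (2 * ampF (d + 1) i + 1)
    else 1
termination_by d i => (d, N + 1 - i, 3)
/-- `Amp(d, i)`, for `d ≥ 1` and `i ≤ N`. -/
def ampF : ℕ → ℕ → ℕ
  | 0, _ => 0
  | d + 1, i =>
    if i ≤ N then
      32 * stabConst N ^ 2 * (H + 2 * maxF d) *
        (Ramsey (typF (d + 1) i) 3 + lenF (d + 1) (i + 1) + lenF d 1)
    else 0
termination_by d i => (d, N + 1 - i, 2)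
/-- `Typ(d, i)`. -/
def typF : ℕ → ℕ → ℕ
  | d, i => 3 ^ i * (2 * covF d i + 2) ^ (2 * N * i)
termination_by d i => (d, N + 1 - i, 1)
/-- `Cov(d, i)`, for `d ≥ 1` and `i ≤ N`. -/
def covF : ℕ → ℕ → ℕ
  | 0, _ => 1
  | d + 1, i =>
    if i < N then
      8 * stabConst N ^ 2 * (maxF d * lenF d 1 * lenF (d + 1) (i + 1) + covF (d + 1) (i + 1) + H)
    else 1
termination_by d i => (d, N + 1 - i, 0)
/-- `MaxWt(d)`. -/
def maxF : ℕ → ℕ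
  | 0 => W
  | d + 1 => 2 * stabConst N * maxF d * lenF (d + 1) i₀
termination_by d => (d, N + 2, 0)
end

end Lengths

/-! ### Bounded alphabets -/

section Alphabets

variable {Q : Type u} {Sig : Type v} [DecidableEq Q] [Fintype Q]

/-- The maximal weight of a standard letter. -/
def stdMaxWt [Fintype Sig] (A : WFA Q Sig) : ℕ :=
  univ.sup fun t : Q × Sig × Q => maxWt A (.std t.1 t.2.1 t.2.2)

/-- The simple length bound. -/
def Lsimp [Fintype Sig] (A : WFA Q Sig) (d : ℕ) : ℕ :=
  lenF (Fintype.card (State Q)) (stdMaxWt A) 0 1 d 1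

/-- The constant `H = Amp(|S|, 0)` of the simple functions. -/
def Hconst [Fintype Sig] (A : WFA Q Sig) : ℕ :=
  ampF (Fintype.card (State Q)) (stdMaxWt A) 0 1 (Fintype.card (State Q)) 0

/-- The general length function `GLen`. -/
def GLen [Fintype Sig] (A : WFA Q Sig) (d i : ℕ) : ℕ :=
  lenF (Fintype.card (State Q)) (stdMaxWt A) (Hconst A) 0 d i

/-- The general length bound. -/
def Lgen [Fintype Sig] (A : WFA Q Sig) (d : ℕ) : ℕ := GLen A d 1

variable (A : WFA Q Sig) (L : ℕ → ℕ)

/-- Standard letters. -/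
def IsStd (σ : Letter Q Sig) : Prop := ∃ p a q, σ = .std p a q

/-- The bounded cactus letters: standard letters and, hereditarily, the non-degenerate cactus letters
`α_{S',w}` of depth `k < |S|` with `|w| ≤ L k`. -/
inductive IsBdd : Letter Q Sig → Prop
  | std (p : Q) (a : Sig) (q : Q) : IsBdd (.std p a q)
  | cactus (S' : Finset (State Q)) (w : List (Letter Q Sig)) :
      (∀ σ ∈ w, IsBdd σ) → IsStableCycle S' (mwt A w) → ¬ IsDegenerate S' (mwt A w) →
      depth w + 1 < Fintype.card (State Q) → w.length ≤ L (depth w + 1) →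
      IsBdd (.cactus S' w)

/-- Bounded cactus letters and the rebase letters they induce. -/
def IsBddReb (σ : Letter Q Sig) : Prop :=
  IsBdd A L σ ∨ ∃ S' w s r, IsBdd A L (.cactus S' w) ∧ IsGrounded S' (mwt A w) s r ∧
    σ = .rebase S' w s r

/-- Cactus letters over words of bounded cactus and rebase letters. -/
def IsBddRebCac (σ : Letter Q Sig) : Prop :=
  ∃ S' w, (∀ τ ∈ w, IsBddReb A L τ) ∧ IsStableCycle S' (mwt A w) ∧
    w.length ≤ L (depth w + 1) ∧ σ = .cactus S' w

/-- Bounded cactus letters, the rebase letters they induce, and jump letters. -/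
def IsBddRebJump (σ : Letter Q Sig) : Prop :=
  IsBddReb A L σ ∨ ∃ p₁ p₂ T, p₁ ∈ T ∧ p₂ ∈ T ∧ σ = .jump p₁ p₂ T

end Alphabets

/-! ### Dominance, potential, charge, and separated repeating infixes -/

section SRI

variable {Q : Type u} {Sig : Type v} [DecidableEq Q] [Fintype Q] [Fintype Sig] (A : WFA Q Sig)

/-- `q` is dominant in the configuration `c`: it is in the support, and some admissible suffix
`z ++ [α]` can be read from `q`, but not from any state of smaller weight. -/
def IsDominant (c : State Q → WithTop ℤ) (q : State Q) : Prop :=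
  c q ≠ ⊤ ∧ ∃ (z : List (Letter Q Sig)) (α : Letter Q Sig),
    (∀ σ ∈ z, IsBddRebJump A (Lsimp A) σ) ∧ IsBddRebCac A (Lgen A) α ∧
    (∃ r, mwt A (z ++ [α]) q r ≠ ⊤) ∧
    ∀ p, c p < c q → ∀ r, mwt A (z ++ [α]) p r = ⊤

open Classical in
/-- The potential of `w`, meaningful if `w` has a seamless baseline run: the maximal weight of a
dominant state in the configuration reached by `w`; it is `⊥` if there is no dominant state. -/
def potential (w : List (Letter Q Sig)) : WithBot (WithTop ℤ) :=
  (univ.filter (IsDominant A (xconf A w))).sup fun q => ((xconf A w q : WithTop ℤ) : WithBot _)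

/-- The charge of `w`, meaningful if `w` has a seamless baseline run: minus the minimal weight in
the configuration reached by `w`. -/
def charge (w : List (Letter Q Sig)) : ℤ := -(univ.inf (xconf A w)).untopD 0

/-- The conditions on a decomposition `w₁w₂w₃` to be charge-decreasing. -/
def IsChargeDecreasing (w₁ w₂ w₃ : List (Letter Q Sig)) : Prop :=
  HasSeamlessBaseline A (w₁ ++ w₂ ++ w₃) ∧ charge A (w₁ ++ w₂) ≤ charge A w₁

/-- `u x y v` is a general separated repeating infix. The sets `V 0, …, V (ℓ - 1)` are the parts of
the partition of the common support, in increasing order of weight. -/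
structure IsGSRI (u x y v : List (Letter Q Sig)) : Prop where
  letters : ∀ σ ∈ u ++ x ++ y ++ v, IsBdd A (Lgen A) σ
  x_ne : x ≠ []
  y_ne : y ≠ []
  supp_x : supp (xconf A (u ++ x)) = supp (xconf A u)
  supp_y : supp (xconf A (u ++ x ++ y)) = supp (xconf A u)
  short : stabConst (Fintype.card (State Q)) * x.length ≤ Lgen A (depth x + 1)
  parts : ∃ (ℓ : ℕ) (V : Fin ℓ → Set (State Q)),
    (∀ j, (V j).Nonempty) ∧ (Pairwise fun i j => Disjoint (V i) (V j)) ∧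
    (⋃ j, V j) = supp (xconf A u) ∧
    (∀ i j : Fin ℓ, (i : ℕ) + 1 = j → ∀ s ∈ V i, ∀ s' ∈ V j,
      ∀ ξ ∈ [u, u ++ x, u ++ x ++ y],
        xconf A ξ s + (((4 * Fintype.card (State Q) * stabConst (Fintype.card (State Q)) *
          maxEff A (x ++ y) + Hconst A : ℕ) : ℤ) : WithTop ℤ) < xconf A ξ s') ∧
    ∀ j, ∃ kx ky : ℤ, kx.sign = ky.sign ∧ ∀ s ∈ V j,
      xconf A (u ++ x) s = xconf A u s + ((kx : ℤ) : WithTop ℤ) ∧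
      xconf A (u ++ x ++ y) s = xconf A (u ++ x) s + ((ky : ℤ) : WithTop ℤ)
  seamless : HasSeamlessBaseline A (u ++ x ++ y ++ v)
  charge_x : charge A (u ++ x) ≤ charge A u
  charge_y : charge A (u ++ x ++ y) ≤ charge A (u ++ x)
  charge_iff : charge A u = charge A (u ++ x) ↔ charge A (u ++ x) = charge A (u ++ x ++ y)

end SRI

end TropWFA

end

noncomputable section
namespace TropWFA
open Finset
universe u v

-- Min-plus powers of a behaviour: cutting cycles and finding zero cycles.

section Powers

variable {Q : Type u} [DecidableEq Q] [Fintype Q]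

-- Suppose that no standard-letter word with a seamless baseline run has potential above `Hconst A`.
-- Two ingredients then yield the infix.
--
-- The minimal weight of a configuration rises slowly. The lowest state from which the next letter
-- can be read is dominant (`exists_isDominant`). A dominant state at height `h` above the minimum
-- would give a standard-letter word of potential at least `h` (`exists_std_potential_ge`). To see
-- this, replace cactus letters by high powers of their words (`exists_approx_stabWt`,
-- `flattenable`). The result traces a path of the original automaton. Taking instead a cheapest
-- path to the lowest state as baseline subtracts the minimum from all weights, and a jump letter
-- restores the old baseline before the suffix that witnesses dominance. So one letter raises the
-- minimum by at most `Hconst A` plus its largest weight (`lowest_snoc_le`).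
--
-- The rest concerns an abstract sequence of configurations (`ConfigSeq`). Fix a block over which
-- the minimum does not drop, and runs that stay far apart on it. A position is good if every finite
-- state lies near one of the runs and a letter of the top depth occurs shortly before it. A
-- position that is not good has a strictly larger minimum at bounded distance before it, or else
-- the infix already exists: an uncovered state, traced back, is one more distant run
-- (`exists_isSepRep_of_runs`, induction on the number of missing runs), and a stretch without
-- top-depth letters is a block of smaller depth (`exists_isSepRep`, induction on the depth). Since
-- the minimum rises slowly and does not drop over the block, `exists_sequence` finds as many good
-- positions as the Ramsey number asks for, with non-decreasing minima. Colour a pair of positions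
-- by the signs of the drifts of the runs and by the offsets of all states from the runs. Two
-- consecutive pairs of equal colour (`exists_ramsey_triple`) give three positions between which the
-- cluster around each run moves rigidly, both times in the same direction (`isSepRep_of_code_eq`).

theorem exists_mpow_succ (M : State Q → State Q → WithTop ℤ) (n : ℕ) (s r : State Q) :
    ∃ t, mpow M (n + 1) s r = M s t + mpow M n t r := by
  obtain ⟨t, -, ht⟩ := Finset.exists_mem_eq_inf (univ : Finset (State Q)) ⟨s, mem_univ s⟩
    fun t => M s t + mpow M n t r
  exact ⟨t, ht⟩

theorem mpow_succ_le (M : State Q → State Q → WithTop ℤ) (n : ℕ) (s t r : State Q) :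
    mpow M (n + 1) s r ≤ M s t + mpow M n t r :=
  Finset.inf_le (f := fun t => M s t + mpow M n t r) (mem_univ t)

theorem mpow_one (M : State Q → State Q → WithTop ℤ) (s r : State Q) : mpow M 1 s r = M s r := by
  apply le_antisymm
  · simpa [mpow] using mpow_succ_le M 0 s r r
  · obtain ⟨t, ht⟩ := exists_mpow_succ M 0 s r
    simp only [zero_add] at ht
    rw [ht]
    by_cases h : t = r
    · simp [mpow, h]
    · simp [mpow, h]

theorem mpow_add_le (M : State Q → State Q → WithTop ℤ) (a b : ℕ) (s t r : State Q) :
    mpow M (a + b) s r ≤ mpow M a s t + mpow M b t r := by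
  induction a generalizing s with
  | zero =>
    by_cases h : s = t
    · simp [mpow, h]
    · simp [mpow, h]
  | succ a ih =>
    obtain ⟨x, hx⟩ := exists_mpow_succ M a s t
    rw [show a + 1 + b = a + b + 1 by omega, hx, add_assoc (M s x)]
    exact (mpow_succ_le M (a + b) s x r).trans (add_le_add le_rfl (ih x))

/-- A walk of minimal weight, with its accumulated weights. -/
theorem exists_walk (M : State Q → State Q → WithTop ℤ) (n : ℕ) (s r : State Q)
    (h : mpow M n s r ≠ ⊤) :
    ∃ (x : ℕ → State Q) (y : ℕ → ℤ), x 0 = s ∧ x n = r ∧ y 0 = 0 ∧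
      ((y n : ℤ) : WithTop ℤ) = mpow M n s r ∧
      ∀ i l, i + l ≤ n → mpow M l (x i) (x (i + l)) ≤ ((y (i + l) - y i : ℤ) : WithTop ℤ) := by
  induction n generalizing s with
  | zero =>
    have hsr : s = r := by
      by_contra hne
      exact h (by simp [mpow, hne])
    subst hsr
    refine ⟨fun _ => s, fun _ => 0, rfl, rfl, rfl, by simp [mpow], fun i l hl => ?_⟩
    obtain rfl : l = 0 := by omega
    simp [mpow]
  | succ n ih =>
    obtain ⟨t, ht⟩ := exists_mpow_succ M n s r
    have h1 : M s t ≠ ⊤ := fun h' => h (by rw [ht, h', top_add])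
    have h2 : mpow M n t r ≠ ⊤ := fun h' => h (by rw [ht, h', add_top])
    obtain ⟨x, y, hx0, hxn, hy0, hyn, hxy⟩ := ih t h2
    obtain ⟨w, hw⟩ := WithTop.ne_top_iff_exists.1 h1
    refine ⟨fun i => Nat.casesOn i s x, fun i => Nat.casesOn i 0 fun i => w + y i, rfl, hxn, rfl,
      ?_, ?_⟩
    · rw [ht, ← hw, ← hyn]; rfl
    · rintro (_ | i) l hl
      · rcases l with _ | l
        · simp [mpow]
        · have h3 := hxy 0 l (by omega)
          have h4 := (mpow_succ_le M l s t (x l)).trans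
            (add_le_add le_rfl (by simpa [hx0] using h3))
          simp only [zero_add]
          refine h4.trans ?_
          rw [← hw, hy0]
          norm_cast
          simp
      · have h3 := hxy i l (by omega)
        have e : i + 1 + l = (i + l) + 1 := by omega
        rw [e]
        simpa using h3

theorem exists_mpow_add (M : State Q → State Q → WithTop ℤ) (a b : ℕ) (s r : State Q) :
    ∃ t, mpow M (a + b) s r = mpow M a s t + mpow M b t r := by
  by_cases h : mpow M (a + b) s r = ⊤
  · exact ⟨s, by rw [h, eq_comm, ← top_le_iff, ← h]; exact mpow_add_le M a b s s r⟩
  · obtain ⟨x, y, hx0, hxn, hy0, hyn, hxy⟩ := exists_walk M (a + b) s r h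
    refine ⟨x a, le_antisymm (mpow_add_le ..) ?_⟩
    have h1 := hxy 0 a (by omega)
    have h2 := hxy a b le_rfl
    rw [zero_add, hx0] at h1
    rw [hxn] at h2
    refine (add_le_add h1 h2).trans ?_
    rw [← hyn, hy0]
    norm_cast
    simp

theorem mpow_mpow (M : State Q → State Q → WithTop ℤ) (a n : ℕ) :
    mpow (mpow M a) n = mpow M (a * n) := by
  induction n with
  | zero => rfl
  | succ n ih =>
    funext s r
    rw [Nat.mul_succ, add_comm (a * n)]
    apply le_antisymm
    · obtain ⟨t, ht⟩ := exists_mpow_add M a (a * n) s r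
      rw [ht, ← ih]
      exact mpow_succ_le ..
    · obtain ⟨t, ht⟩ := exists_mpow_succ (mpow M a) n s r
      rw [ht, ih]
      exact mpow_add_le ..

theorem mpow_closed {M : State Q → State Q → WithTop ℤ} {S' : Finset (State Q)}
    (hcl : ∀ s ∈ S', ∀ r, M s r ≠ ⊤ → r ∈ S') (n : ℕ) :
    ∀ s ∈ S', ∀ r, mpow M n s r ≠ ⊤ → r ∈ S' := by
  induction n with
  | zero =>
    intro s hs r h
    by_cases e : s = r
    · exact e ▸ hs
    · simp [mpow, e] at h
  | succ n ih =>
    intro s hs r h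
    obtain ⟨t, ht⟩ := exists_mpow_succ M n s r
    rw [ht, ne_eq, WithTop.add_eq_top, not_or] at h
    exact ih t (hcl s hs t h.1) r h.2

/-- A cycle can be cut out of a long walk, after its first `lo` steps. -/
theorem exists_shorter {M : State Q → State Q → WithTop ℤ} {S' : Finset (State Q)}
    (hcl : ∀ s ∈ S', ∀ r, M s r ≠ ⊤ → r ∈ S') (hnn : ∀ n, ∀ s ∈ S', 0 ≤ mpow M n s s)
    (lo n : ℕ) (hn : Fintype.card (State Q) + lo ≤ n) (s : State Q) (hs : s ∈ S') (r : State Q) :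
    ∃ n', lo ≤ n' ∧ n' < n ∧ mpow M n' s r ≤ mpow M n s r := by
  have hpos : 0 < Fintype.card (State Q) := Fintype.card_pos_iff.2 ⟨s⟩
  by_cases h : mpow M n s r = ⊤
  · exact ⟨lo, le_rfl, by omega, by rw [h]; exact le_top⟩
  obtain ⟨x, y, hx0, hxn, hy0, hyn, hxy⟩ := exists_walk M n s r h
  obtain ⟨i, hi, j, hj, hij, he⟩ : ∃ i ∈ Finset.Icc lo n, ∃ j ∈ Finset.Icc lo n, i ≠ j ∧ x i = x j :=
    Finset.exists_ne_map_eq_of_card_lt_of_maps_to (t := univ) (by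
      rw [Finset.card_univ, Nat.card_Icc]; omega) (fun _ _ => mem_univ _)
  wlog hlt : i < j generalizing i j
  · exact this j hj i hi hij.symm he.symm (by omega)
  rw [Finset.mem_Icc] at hi hj
  have h1 := hxy 0 i (by omega)
  have h2 := hxy i (j - i) (by omega)
  have h3 := hxy j (n - j) (by omega)
  rw [zero_add, hx0] at h1
  rw [Nat.add_sub_cancel' hlt.le, ← he] at h2
  rw [Nat.add_sub_cancel' hj.2, hxn, ← he] at h3
  have hi' : x i ∈ S' := mpow_closed hcl i s hs _ (ne_top_of_le_ne_top WithTop.coe_ne_top h1)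
  have h4 := (hnn (j - i) _ hi').trans h2
  refine ⟨i + (n - j), by omega, by omega, (mpow_add_le M i (n - j) s (x i) r).trans
    ((add_le_add h1 h3).trans ?_)⟩
  rw [← hyn]
  norm_cast at h4 ⊢
  omega

theorem exists_short {M : State Q → State Q → WithTop ℤ} {S' : Finset (State Q)}
    (hcl : ∀ s ∈ S', ∀ r, M s r ≠ ⊤ → r ∈ S') (hnn : ∀ n, ∀ s ∈ S', 0 ≤ mpow M n s s)
    (lo n : ℕ) (hn : lo ≤ n) (s : State Q) (hs : s ∈ S') (r : State Q) :
    ∃ n', lo ≤ n' ∧ n' < Fintype.card (State Q) + lo ∧ mpow M n' s r ≤ mpow M n s r := by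
  induction n using Nat.strong_induction_on with
  | _ n ih =>
    by_cases h : n < Fintype.card (State Q) + lo
    · exact ⟨n, hn, h, le_rfl⟩
    · obtain ⟨k, h1, h2, h3⟩ := exists_shorter hcl hnn lo n (by omega) s hs r
      obtain ⟨n', h4, h5, h6⟩ := ih k h2 h1
      exact ⟨n', h4, h5, h6.trans h3⟩

theorem mpow_zero_cycle {M : State Q → State Q → WithTop ℤ} {g : State Q} {a : ℕ}
    (h : mpow M a g g ≤ 0) (n : ℕ) : mpow M (a * n) g g ≤ 0 := by
  induction n with
  | zero => simp [mpow]
  | succ n ih =>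
    rw [Nat.mul_succ]
    refine (mpow_add_le M _ _ g g g).trans ((add_le_add ih h).trans (by simp))

/-- Cutting cycles of non-negative weight shortens the cycle to a positive length of at most `card`,
and such a length divides the factorial. -/
theorem mpow_factorial_cycle {M : State Q → State Q → WithTop ℤ} {S' : Finset (State Q)}
    (hcl : ∀ s ∈ S', ∀ r, M s r ≠ ⊤ → r ∈ S') (hnn : ∀ n, ∀ s ∈ S', 0 ≤ mpow M n s s)
    {g : State Q} (hg : g ∈ S') {l : ℕ} (hl : 1 ≤ l) (h : mpow M l g g ≤ 0) :
    mpow M (Fintype.card (State Q)).factorial g g ≤ 0 := by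
  obtain ⟨l', h1, h2, h3⟩ := exists_short hcl hnn 1 l hl g hg g
  obtain ⟨k, hk⟩ := Nat.dvd_factorial (show 0 < l' by omega) (show l' ≤ Fintype.card (State Q) by omega)
  rw [hk]
  exact mpow_zero_cycle (h3.trans h) k

/-- With a zero cycle at the target, every walk can be normalised to `card` steps. -/
theorem mpow_card_le_left {M : State Q → State Q → WithTop ℤ} {S' : Finset (State Q)}
    (hcl : ∀ s ∈ S', ∀ r, M s r ≠ ⊤ → r ∈ S') (hnn : ∀ n, ∀ s ∈ S', 0 ≤ mpow M n s s)
    {s g : State Q} (hs : s ∈ S') (h : M g g ≤ 0) (n : ℕ) :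
    mpow M (Fintype.card (State Q)) s g ≤ mpow M n s g := by
  obtain ⟨n', -, h2, h3⟩ := exists_short hcl hnn 0 n (Nat.zero_le _) s hs g
  have e : Fintype.card (State Q) = n' + 1 * (Fintype.card (State Q) - n') := by omega
  rw [e]
  refine (mpow_add_le M _ _ s g g).trans ((add_le_add h3 (mpow_zero_cycle ?_ _)).trans (by simp))
  rwa [mpow_one]

/-- With a zero cycle at the source, every walk can be normalised to `card` steps. -/
theorem mpow_card_le_right {M : State Q → State Q → WithTop ℤ} {S' : Finset (State Q)}
    (hcl : ∀ s ∈ S', ∀ r, M s r ≠ ⊤ → r ∈ S') (hnn : ∀ n, ∀ s ∈ S', 0 ≤ mpow M n s s)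
    {g r : State Q} (hs : g ∈ S') (h : M g g ≤ 0) (n : ℕ) :
    mpow M (Fintype.card (State Q)) g r ≤ mpow M n g r := by
  obtain ⟨n', -, h2, h3⟩ := exists_short hcl hnn 0 n (Nat.zero_le _) g hs r
  have e : Fintype.card (State Q) = 1 * (Fintype.card (State Q) - n') + n' := by omega
  rw [e]
  refine (mpow_add_le M _ _ g g r).trans ((add_le_add (mpow_zero_cycle ?_ _) h3).trans (by simp))
  rwa [mpow_one]

theorem exists_bound {ι : Type*} [Finite ι] (f : ι → WithTop ℤ) :
    ∃ C : ℕ, ∀ i, ((-(C : ℤ) : ℤ) : WithTop ℤ) ≤ f i ∧ (f i ≠ ⊤ → f i ≤ ((C : ℤ) : WithTop ℤ)) := by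
  have := Fintype.ofFinite ι
  refine ⟨univ.sup fun i => ((f i).untopD 0).natAbs, fun i => ?_⟩
  have h := Finset.le_sup (f := fun i => ((f i).untopD 0).natAbs) (mem_univ i)
  set C := univ.sup fun i => ((f i).untopD 0).natAbs
  cases hi : f i with
  | top => simp
  | coe v =>
    rw [hi, WithTop.untopD_coe] at h
    refine ⟨WithTop.coe_le_coe.2 (by omega), fun _ => WithTop.coe_le_coe.2 (by omega)⟩

/-- A long walk of bounded weight passes through a zero cycle. -/
theorem exists_zero_cycle {M : State Q → State Q → WithTop ℤ} {S' : Finset (State Q)}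
    (hcl : ∀ s ∈ S', ∀ r, M s r ≠ ⊤ → r ∈ S') (hnn : ∀ n, ∀ s ∈ S', 0 ≤ mpow M n s s) (C : ℤ) :
    ∃ n₀, ∀ n ≥ n₀, ∀ s ∈ S', ∀ r, mpow M n s r ≤ (C : WithTop ℤ) →
      ∃ g ∈ S', ∃ l ≥ 1, mpow M l g g ≤ 0 ∧ ∃ a b,
        mpow M a s g + mpow M b g r ≤ mpow M n s r := by
  obtain ⟨D, hD⟩ := exists_bound fun p : Fin (Fintype.card (State Q)) × State Q × State Q =>
    mpow M p.1 p.2.1 p.2.2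
  -- Shortening never raises the weight, so the finitely many walks of fewer than `card` steps bound
  -- all weights from below.
  have hlow : ∀ n, ∀ s ∈ S', ∀ r, ((-(D : ℤ) : ℤ) : WithTop ℤ) ≤ mpow M n s r := by
    intro n s hs r
    obtain ⟨n', -, h2, h3⟩ := exists_short hcl hnn 0 n (Nat.zero_le _) s hs r
    exact (hD (⟨n', h2⟩, s, r)).1.trans h3
  -- The lower bound, applied to a prefix and to the remaining suffix, confines the accumulated
  -- weight to an interval. A walk with more positions than pairs of state and weight repeats a
  -- pair, which is a zero cycle.
  refine ⟨(univ ×ˢ Finset.Icc (-(D : ℤ)) (C + D) : Finset (State Q × ℤ)).card,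
    fun n hn s hs r hC => ?_⟩
  obtain ⟨x, y, hx0, hxn, hy0, hyn, hxy⟩ := exists_walk M n s r
    (ne_top_of_le_ne_top WithTop.coe_ne_top hC)
  rw [← hyn, WithTop.coe_le_coe] at hC
  have hmem : ∀ i ≤ n, x i ∈ S' := fun i hi => by
    have h1 := hxy 0 i (by omega)
    rw [zero_add, hx0] at h1
    exact mpow_closed hcl i s hs _ (ne_top_of_le_ne_top WithTop.coe_ne_top h1)
  obtain ⟨i, hi, j, hj, hij, he⟩ : ∃ i ∈ Finset.range (n + 1), ∃ j ∈ Finset.range (n + 1), i ≠ j ∧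
      (x i, y i) = (x j, y j) :=
    Finset.exists_ne_map_eq_of_card_lt_of_maps_to
      (t := (univ ×ˢ Finset.Icc (-(D : ℤ)) (C + D) : Finset (State Q × ℤ))) (by
      rw [Finset.card_range]; omega) (by
      intro i hi
      rw [Finset.mem_coe, Finset.mem_range] at hi
      have h1 := hxy 0 i (by omega)
      have h3 := hxy i (n - i) (by omega)
      rw [zero_add, hx0] at h1
      rw [Nat.add_sub_cancel' (by omega), hxn] at h3
      have h1' := WithTop.coe_le_coe.1 ((hlow i s hs _).trans h1)
      have h3' := WithTop.coe_le_coe.1 ((hlow _ _ (hmem i (by omega)) _).trans h3)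
      simp only [coe_product, coe_univ, coe_Icc, Set.mem_prod, Set.mem_univ, Set.mem_Icc, true_and]
      omega)
  wlog hlt : i < j generalizing i j
  · exact this j hj i hi hij.symm he.symm (by omega)
  rw [Prod.mk.injEq] at he
  rw [Finset.mem_range] at hi hj
  have h1 := hxy 0 i (by omega)
  have h2 := hxy i (j - i) (by omega)
  have h3 := hxy i (n - i) (by omega)
  rw [zero_add, hx0] at h1
  rw [Nat.add_sub_cancel' hlt.le, ← he.1, ← he.2, sub_self] at h2
  rw [Nat.add_sub_cancel' (by omega), hxn] at h3
  refine ⟨x i, hmem i (by omega), j - i, by omega, h2, i, n - i, (add_le_add h1 h3).trans ?_⟩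
  rw [← hyn]
  norm_cast
  omega

end Powers

-- Cactus transitions as limits of powers.

section Stable

variable {Q : Type u} [DecidableEq Q] [Fintype Q] {M : State Q → State Q → WithTop ℤ}
  {S' : Finset (State Q)}

/-- The baseline state has the least cycle for every power, and its weight is zero. This is the only
form in which stability enters the cycle-cutting arguments. -/
theorem mpow_cycle_nonneg {b : State Q}
    (hb : ∀ n : ℕ, b ∈ minStates S' (mpow M n) ∧ mpow M n b b = 0) (n : ℕ) :
    ∀ s ∈ S', 0 ≤ mpow M n s s := by
  intro s hs
  by_cases h : mpow M n s s = ⊤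
  · rw [h]; exact le_top
  · obtain ⟨h1, h2⟩ := hb n
    rw [← h2]
    exact (Finset.mem_filter.1 h1).2 s (Finset.mem_filter.2 ⟨hs, h⟩)

/-- Approximation of a weight `a` by a weight `b`: equal if finite, otherwise large. -/
def Approx (K : ℤ) (a b : WithTop ℤ) : Prop := (a ≠ ⊤ → b = a) ∧ (a = ⊤ → (K : WithTop ℤ) ≤ b)

theorem Approx.trans {K : ℤ} {a b c : WithTop ℤ} (h : Approx K a b) (h' : Approx K b c) :
    Approx K a c := by
  refine ⟨fun ha => ?_, fun ha => ?_⟩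
  · have e := h.1 ha
    rw [h'.1 (e ▸ ha), e]
  · by_cases hb : b = ⊤
    · exact h'.2 hb
    · rw [h'.1 hb]; exact h.2 ha

/-- The transitions on a cactus letter approximate high powers of its word. -/
theorem exists_approx_stabWt (h : IsStableCycle S' M) (K : ℤ) :
    ∃ n : ℕ, ∀ s ∈ S', ∀ r, Approx K (stabWt S' M s r) (mpow M n s r) := by
  obtain ⟨b, hrc, hb⟩ := h
  have hcl := hrc.2
  have hnn := mpow_cycle_nonneg hb
  set N := Fintype.card (State Q) with hN
  have hm : stabConst N = N.factorial * N := by rw [stabConst, mul_comm]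
  have hnn' : ∀ a n, ∀ s ∈ S', 0 ≤ mpow (mpow M a) n s s := fun a n s hs => by
    rw [mpow_mpow]; exact hnn _ s hs
  obtain ⟨C, hC⟩ := exists_bound fun p : State Q × State Q => stabWt S' M p.1 p.2
  -- The bound `max C K` covers both uses: finite cactus weights are at most `C`, and weights below
  -- `K` must be ruled out for pairs that are not grounded.
  obtain ⟨n₀, hn₀⟩ := exists_zero_cycle (mpow_closed hcl (stabConst N)) (hnn' _) (max C K)
  -- One block leads to the grounding state, `n₀` blocks loop there, and one block leads away. The
  -- total is also long enough to force a zero cycle.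
  refine ⟨stabConst N * (n₀ + 2), fun s hs r => ?_⟩
  have hlow : mpow M (stabConst N * (n₀ + 2)) s r ≤ ((max C K : ℤ) : WithTop ℤ) →
      IsGrounded S' M s r ∧ stabWt S' M s r ≤ mpow M (stabConst N * (n₀ + 2)) s r := by
    intro hle
    have hr : r ∈ S' := mpow_closed hcl _ s hs r (ne_top_of_le_ne_top WithTop.coe_ne_top hle)
    rw [← mpow_mpow] at hle ⊢
    obtain ⟨g, hg, l, hl, hgl, a, c, hac⟩ := hn₀ (n₀ + 2) (by omega) s hs r hle
    rw [mpow_mpow] at hgl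
    have hposm : 0 < stabConst N := by
      have : 0 < N := Fintype.card_pos_iff.2 ⟨s⟩
      rw [stabConst]; positivity
    have hfac : mpow M N.factorial g g ≤ 0 :=
      mpow_factorial_cycle hcl hnn hg (Nat.mul_pos hposm hl) hgl
    have hgm : mpow M (stabConst N) g g = 0 :=
      le_antisymm (by rw [hm]; exact mpow_zero_cycle hfac N) (hnn _ g hg)
    have hgmin : g ∈ minStates S' (mpow M (stabConst N)) := by
      refine Finset.mem_filter.2 ⟨Finset.mem_filter.2 ⟨hg, by rw [hgm]; simp⟩, fun r hr => ?_⟩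
      rw [hgm]; exact hnn _ r (Finset.mem_filter.1 hr).1
    -- In the behaviour of `w ^ N!` the state `g` has a zero loop, so any walk to it can be brought
    -- to exactly `N` steps, which is `stabConst N` readings of `w`.
    have e1 : mpow M (stabConst N) s g ≤ mpow (mpow M (stabConst N)) a s g := by
      have := mpow_card_le_left (mpow_closed hcl N.factorial) (hnn' _) hs hfac (N * a)
      rwa [mpow_mpow, mpow_mpow, ← mul_assoc, ← hm, ← mpow_mpow] at this
    have e2 : mpow M (stabConst N) g r ≤ mpow (mpow M (stabConst N)) c g r := by
      have := mpow_card_le_right (r := r) (mpow_closed hcl N.factorial) (hnn' _) hg hfac (N * c)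
      rwa [mpow_mpow, mpow_mpow, ← mul_assoc, ← hm, ← mpow_mpow] at this
    have e3 := (add_le_add e1 e2).trans hac
    have hfin := ne_top_of_le_ne_top (ne_top_of_le_ne_top WithTop.coe_ne_top hle) e3
    rw [ne_eq, WithTop.add_eq_top, not_or] at hfin
    have hgr : IsGrounded S' M s r := ⟨hs, hr, g, hgmin, hfin.1, hfin.2⟩
    refine ⟨hgr, ?_⟩
    rw [stabWt, if_pos hgr]
    exact (Finset.inf_le hgmin).trans e3
  refine ⟨fun hfin => ?_, fun htop => ?_⟩
  · have hgr : IsGrounded S' M s r := by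
      by_contra hgr
      exact hfin (by rw [stabWt, if_neg hgr])
    -- Conversely, minimality puts the cycle of `g` below that of the baseline state, which is zero,
    -- so looping at `g` costs nothing.
    have hle : mpow M (stabConst N * (n₀ + 2)) s r ≤ stabWt S' M s r := by
      rw [stabWt, if_pos hgr]
      refine Finset.le_inf fun g hg => ?_
      have hg0 : mpow M (stabConst N) g g ≤ 0 := by
        rw [← (hb (stabConst N)).2]
        exact (Finset.mem_filter.1 hg).2 b (Finset.mem_filter.1 (hb (stabConst N)).1).1
      have e : stabConst N * (n₀ + 2) = stabConst N + (stabConst N * n₀ + stabConst N) := by ring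
      rw [e]
      refine (mpow_add_le M _ _ s g r).trans (add_le_add le_rfl ?_)
      refine (mpow_add_le M _ _ g g r).trans ?_
      exact (add_le_add (mpow_zero_cycle hg0 n₀) le_rfl).trans (by simp [hN])
    refine le_antisymm hle (hlow ?_).2
    exact hle.trans (((hC (s, r)).2 hfin).trans (WithTop.coe_le_coe.2 (le_max_left _ _)))
  · by_contra hlt
    rw [not_le] at hlt
    have h1 := (hlow (hlt.le.trans (WithTop.coe_le_coe.2 (le_max_right _ _)))).2
    rw [htop, top_le_iff] at h1
    rw [h1] at hlt
    exact not_top_lt hlt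

end Stable

-- Replacing cactus letters by standard letters.

section Flatten

variable {Q : Type u} {Sig : Type v} [DecidableEq Q] [Fintype Q] {A : WFA Q Sig} {L : ℕ → ℕ}

theorem mwt_append_le (A : WFA Q Sig) (w w' : List (Letter Q Sig)) (s t r : State Q) :
    mwt A (w ++ w') s r ≤ mwt A w s t + mwt A w' t r := by
  rw [mwt_append]
  exact Finset.inf_le (f := fun t => mwt A w s t + mwt A w' t r) (mem_univ t)

theorem exists_mwt_append (A : WFA Q Sig) (w w' : List (Letter Q Sig)) (s r : State Q) :
    ∃ t, mwt A (w ++ w') s r = mwt A w s t + mwt A w' t r := by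
  obtain ⟨t, -, ht⟩ := Finset.exists_mem_eq_inf (univ : Finset (State Q)) ⟨s, mem_univ s⟩
    fun t => mwt A w s t + mwt A w' t r
  exact ⟨t, by rw [mwt_append, ht]⟩

theorem mwt_singleton (A : WFA Q Sig) (σ : Letter Q Sig) (s r : State Q) :
    mwt A [σ] s r = letterWt A σ s r := by
  apply le_antisymm
  · simp only [mwt]
    refine (Finset.inf_le (mem_univ r)).trans ?_
    simp
  · simp only [mwt]
    refine Finset.le_inf fun t _ => ?_
    by_cases h : t = r
    · simp [h]
    · simp [h]

theorem mwt_cons (A : WFA Q Sig) (σ : Letter Q Sig) (w : List (Letter Q Sig)) (s r : State Q) :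
    ∃ t, mwt A (σ :: w) s r = letterWt A σ s t + mwt A w t r := by
  obtain ⟨t, ht⟩ := exists_mwt_append A [σ] w s r
  exact ⟨t, by rw [← mwt_singleton, ← ht]; rfl⟩

theorem letterWt_cactus (A : WFA Q Sig) (S' : Finset (State Q)) (w : List (Letter Q Sig)) :
    letterWt A (.cactus S' w) = stabWt S' (mwt A w) := by
  funext s r
  simp only [letterWt]

theorem letterWt_std (A : WFA Q Sig) (p : Q) (a : Sig) (q : Q) (s r : State Q) :
    letterWt A (.std p a q) s r =
      if base s = p ∧ base r = q ∧ reach r = succ A (reach s) a then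
        A.wt (inner s) a (inner r) + (A.wt p a q).map fun c => -c
      else ⊤ := by
  simp only [letterWt]

theorem letterWt_jump (A : WFA Q Sig) (p₁ p₂ : Q) (T : Finset Q) (s r : State Q) :
    letterWt A (.jump p₁ p₂ T) s r =
      if base s = p₁ ∧ reach s = T ∧ base r = p₂ ∧ reach r = T ∧ inner r = inner s then 0
      else ⊤ := by
  simp only [letterWt]

omit [Fintype Q] in
theorem state_ext {s r : State Q} (h1 : inner s = inner r) (h2 : base s = base r)
    (h3 : reach s = reach r) : s = r :=
  Subtype.ext (Prod.ext h1 (Prod.ext h2 h3))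

theorem isGrounded_of_stabWt_ne_top {S' : Finset (State Q)} {M : State Q → State Q → WithTop ℤ}
    {s r : State Q} (h : stabWt S' M s r ≠ ⊤) : IsGrounded S' M s r := by
  by_contra hgr
  exact h (by rw [stabWt, if_neg hgr])

/-- The base component and the reachable set evolve deterministically. -/
theorem letterWt_deterministic {σ : Letter Q Sig} (hσ : IsBdd A L σ) {s s' r r' : State Q}
    (hr : reach s = reach s') (h : letterWt A σ s r ≠ ⊤)
    (h' : letterWt A σ s' r' ≠ ⊤) : base r = base r' ∧ reach r = reach r' := by
  cases hσ with
  | std p a q =>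
    rw [letterWt_std] at h h'
    split_ifs at h h' with h1 h2
    · exact ⟨h1.2.1.trans h2.2.1.symm, by rw [h1.2.2, h2.2.2, hr]⟩
    all_goals simp at h h'
  | cactus S' w _ hst _ _ _ =>
    rw [letterWt_cactus] at h h'
    obtain ⟨b, hrc, -⟩ := hst
    have h1 := (hrc.1.2 r).1 (isGrounded_of_stabWt_ne_top h).2.1
    have h2 := (hrc.1.2 r').1 (isGrounded_of_stabWt_ne_top h').2.1
    exact ⟨h1.1.trans h2.1.symm, h1.2.trans h2.2.symm⟩

/-- Flattening a suffix depends on the class of its start state. Determinism lets one flattening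
serve all intermediate states reached by the prefix. -/
theorem mwt_deterministic {w : List (Letter Q Sig)} (hw : ∀ σ ∈ w, IsBdd A L σ)
    {s s' r r' : State Q} (hb : base s = base s') (hr : reach s = reach s')
    (h : mwt A w s r ≠ ⊤) (h' : mwt A w s' r' ≠ ⊤) : base r = base r' ∧ reach r = reach r' := by
  induction w generalizing s s' with
  | nil =>
    have h1 : s = r := by
      by_contra hne
      exact h (by simp [mwt, hne])
    have h2 : s' = r' := by
      by_contra hne
      exact h' (by simp [mwt, hne])
    subst h1 h2
    exact ⟨hb, hr⟩
  | cons σ w ih =>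
    obtain ⟨t, ht⟩ := mwt_cons A σ w s r
    obtain ⟨t', ht'⟩ := mwt_cons A σ w s' r'
    rw [ht, ne_eq, WithTop.add_eq_top, not_or] at h
    rw [ht', ne_eq, WithTop.add_eq_top, not_or] at h'
    obtain ⟨h1, h2⟩ := letterWt_deterministic (hw σ (by simp)) hr h.1 h'.1
    exact ih (fun τ hτ => hw τ (by simp [hτ])) h1 h2 h.2 h'.2

/-- From any configuration class where it can be read, `w` is approximated by words of standard
letters. -/
def Flattenable (A : WFA Q Sig) (w : List (Letter Q Sig)) : Prop :=
  ∀ s, (∃ r, mwt A w s r ≠ ⊤) → ∀ K : ℤ, ∃ w' : List (Letter Q Sig), (∀ σ ∈ w', IsStd σ) ∧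
    ∀ s', base s' = base s → reach s' = reach s → ∀ r, Approx K (mwt A w s' r) (mwt A w' s' r)

theorem Flattenable.nil : Flattenable A [] :=
  fun _ _ K => ⟨[], by simp, fun s' _ _ r => ⟨fun _ => rfl, fun h => by rw [h]; exact le_top⟩⟩

/-- The suffix is flattened first, with a threshold that outweighs the prefix. The prefix comes
second, as its threshold must outweigh the flattened suffix, whose negative weights can be large.
Spurious runs then never beat genuine ones. -/
theorem Flattenable.append {w₁ w₂ : List (Letter Q Sig)} (hw₁ : ∀ σ ∈ w₁, IsBdd A L σ)
    (h₁ : Flattenable A w₁) (h₂ : Flattenable A w₂) : Flattenable A (w₁ ++ w₂) := by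
  rintro s ⟨r, hr⟩ K
  obtain ⟨t₀, ht₀⟩ := exists_mwt_append A w₁ w₂ s r
  rw [ht₀, ne_eq, WithTop.add_eq_top, not_or] at hr
  obtain ⟨C, hC⟩ := exists_bound fun p : State Q × State Q => mwt A (w₁ ++ w₂) p.1 p.2
  obtain ⟨C₁, hC₁⟩ := exists_bound fun p : State Q × State Q => mwt A w₁ p.1 p.2
  obtain ⟨w₂', hs₂, ha₂⟩ := h₂ t₀ ⟨r, hr.2⟩ (max (C : ℤ) K + C₁)
  obtain ⟨C₂, hC₂⟩ := exists_bound fun p : State Q × State Q => mwt A w₂' p.1 p.2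
  obtain ⟨w₁', hs₁, ha₁⟩ := h₁ s ⟨t₀, hr.1⟩ (max (C : ℤ) K + C₂)
  refine ⟨w₁' ++ w₂', fun σ hσ => (List.mem_append.1 hσ).elim (hs₁ σ) (hs₂ σ),
    fun s' hb hrc r' => ?_⟩
  -- Through each intermediate state the flattened weight is either exact or above both `C` and `K`.
  have key : ∀ t, (mwt A w₁ s' t ≠ ⊤ ∧ mwt A w₂ t r' ≠ ⊤ ∧
      mwt A w₁' s' t + mwt A w₂' t r' = mwt A w₁ s' t + mwt A w₂ t r') ∨
      ((max (C : ℤ) K : ℤ) : WithTop ℤ) ≤ mwt A w₁' s' t + mwt A w₂' t r' := by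
    intro t
    by_cases h1 : mwt A w₁ s' t = ⊤
    · right
      refine le_trans ?_ (add_le_add ((ha₁ s' hb hrc t).2 h1) (hC₂ (t, r')).1)
      rw [← WithTop.coe_add, WithTop.coe_le_coe]
      omega
    · obtain ⟨hb', hr'⟩ := mwt_deterministic hw₁ hb hrc h1 hr.1
      by_cases h2 : mwt A w₂ t r' = ⊤
      · right
        rw [(ha₁ s' hb hrc t).1 h1]
        refine le_trans ?_ (add_le_add (hC₁ (s', t)).1 ((ha₂ t hb' hr' r').2 h2))
        rw [← WithTop.coe_add, WithTop.coe_le_coe]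
        omega
      · exact Or.inl ⟨h1, h2, by rw [(ha₁ s' hb hrc t).1 h1, (ha₂ t hb' hr' r').1 h2]⟩
  obtain ⟨t', ht'⟩ := exists_mwt_append A w₁' w₂' s' r'
  refine ⟨fun hfin => le_antisymm ?_ ?_, fun htop => ?_⟩
  · obtain ⟨t, ht⟩ := exists_mwt_append A w₁ w₂ s' r'
    have hfin' := hfin
    rw [ht, ne_eq, WithTop.add_eq_top, not_or] at hfin'
    obtain ⟨hb', hr'⟩ := mwt_deterministic hw₁ hb hrc hfin'.1 hr.1
    rw [ht, ← (ha₁ s' hb hrc t).1 hfin'.1, ← (ha₂ t hb' hr' r').1 hfin'.2]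
    exact mwt_append_le ..
  · rw [ht']
    rcases key t' with ⟨-, -, h⟩ | h
    · rw [h]; exact mwt_append_le ..
    · exact ((hC (s', r')).2 hfin).trans ((WithTop.coe_le_coe.2 (le_max_left _ _)).trans h)
  · rw [ht']
    rcases key t' with ⟨h1, h2, -⟩ | h
    · have := mwt_append_le A w₁ w₂ s' t' r'
      rw [htop, top_le_iff, WithTop.add_eq_top] at this
      exact absurd this (not_or.2 ⟨h1, h2⟩)
    · exact (WithTop.coe_le_coe.2 (le_max_right _ _)).trans h

theorem Flattenable.of_letters {w : List (Letter Q Sig)} (hw : ∀ σ ∈ w, IsBdd A L σ)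
    (h : ∀ σ ∈ w, Flattenable A [σ]) : Flattenable A w := by
  induction w with
  | nil => exact .nil
  | cons σ w ih =>
    exact Flattenable.append (w₁ := [σ]) (by simpa using hw σ (by simp)) (h σ (by simp))
      (ih (fun τ hτ => hw τ (by simp [hτ])) fun τ hτ => h τ (by simp [hτ]))

/-- A cactus letter is approximated by a high power of its word, and the letters of that word are
flattenable by induction. -/
theorem flattenable_letter {σ : Letter Q Sig} (hσ : IsBdd A L σ) : Flattenable A [σ] := by
  induction hσ with
  | std p a q =>
    exact fun _ _ K => ⟨[.std p a q], by simp [IsStd], fun s' _ _ r =>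
      ⟨fun _ => rfl, fun h => by rw [h]; exact le_top⟩⟩
  | cactus S' w hw hst hnd hd hl ih =>
    rintro s ⟨r, hr⟩ K
    rw [mwt_singleton, letterWt_cactus] at hr
    have hs := (isGrounded_of_stabWt_ne_top hr).1
    obtain ⟨n, hn⟩ := exists_approx_stabWt hst K
    obtain ⟨b, hrc, hb⟩ := hst
    have hpow : ∀ τ ∈ (List.replicate n w).flatten, τ ∈ w := fun τ hτ => by
      obtain ⟨l, hl, hτ⟩ := List.mem_flatten.1 hτ
      rwa [List.eq_of_mem_replicate hl] at hτ
    have hf : Flattenable A (List.replicate n w).flatten :=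
      .of_letters (fun τ hτ => hw τ (hpow τ hτ)) fun τ hτ => ih τ (hpow τ hτ)
    -- Flattening needs a start state from which the power can be read: the baseline state has a
    -- zero cycle on it, and it represents the whole class.
    obtain ⟨w', hw', ha⟩ := hf b ⟨b, by rw [mwt_pow, (hb n).2]; simp⟩ K
    refine ⟨w', hw', fun s' hbs hrs r' => ?_⟩
    have hs' : base s' = base b ∧ reach s' = reach b := by
      rw [hbs, hrs]; exact (hrc.1.2 s).1 hs
    rw [mwt_singleton, letterWt_cactus]
    have h1 := hn s' ((hrc.1.2 s').2 hs') r'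
    rw [← mwt_pow] at h1
    exact h1.trans (ha s' hs'.1 hs'.2 r')

theorem flattenable {w : List (Letter Q Sig)} (hw : ∀ σ ∈ w, IsBdd A L σ) : Flattenable A w :=
  .of_letters hw fun σ hσ => flattenable_letter (hw σ hσ)

end Flatten

-- Standard words as paths of the original automaton.

section Paths

variable {Q : Type u} {Sig : Type v} [DecidableEq Q] [Fintype Q] (A : WFA Q Sig)

/-- The last state of a path of the automaton from its initial state; paths are given by the list of
their letters and target states, in reverse order. -/
def pathEnd : List (Sig × Q) → Q
  | [] => A.init
  | x :: _ => x.2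

/-- The word of standard letters along a path. -/
def pathWord : List (Sig × Q) → List (Letter Q Sig)
  | [] => []
  | x :: l => pathWord l ++ [.std (pathEnd A l) x.1 x.2]

/-- The weight of a path. -/
def pathWt : List (Sig × Q) → WithTop ℤ
  | [] => 0
  | x :: l => pathWt l + A.wt (pathEnd A l) x.1 x.2

/-- The states reachable on a (reversed) word. -/
def reachOf : List Sig → Finset Q
  | [] => {A.init}
  | a :: v => succ A (reachOf v) a

/-- The configuration of the automaton after a (reversed) word. -/
def conf : List Sig → Q → WithTop ℤ
  | [] => fun q => if q = A.init then 0 else ⊤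
  | a :: v => fun q => univ.inf fun p => conf v p + A.wt p a q

variable {A}

omit [DecidableEq Q] [Fintype Q] in
theorem pathEnd_cons (x : Sig × Q) (l : List (Sig × Q)) : pathEnd A (x :: l) = x.2 := rfl

theorem exists_conf_cons (a : Sig) (v : List Sig) (q : Q) :
    ∃ p, conf A (a :: v) q = conf A v p + A.wt p a q := by
  obtain ⟨t, -, ht⟩ := Finset.exists_mem_eq_inf (univ : Finset Q) ⟨q, mem_univ q⟩
    fun p => conf A v p + A.wt p a q
  exact ⟨t, ht⟩

theorem conf_cons_le (a : Sig) (v : List Sig) (p q : Q) :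
    conf A (a :: v) q ≤ conf A v p + A.wt p a q :=
  Finset.inf_le (f := fun p => conf A v p + A.wt p a q) (mem_univ p)

theorem mem_reachOf {v : List Sig} {q : Q} (h : conf A v q ≠ ⊤) : q ∈ reachOf A v := by
  induction v generalizing q with
  | nil =>
    rw [reachOf, mem_singleton]
    by_contra hne
    exact h (by simp [conf, hne])
  | cons a v ih =>
    obtain ⟨p, hp⟩ := exists_conf_cons (A := A) a v q
    rw [hp, ne_eq, WithTop.add_eq_top, not_or] at h
    simp only [reachOf, succ, mem_filter, mem_univ, true_and]
    exact ⟨p, ih h.1, h.2⟩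

theorem conf_pathEnd_le (l : List (Sig × Q)) :
    conf A (l.map Prod.fst) (pathEnd A l) ≤ pathWt A l := by
  induction l with
  | nil => simp [conf, pathEnd, pathWt]
  | cons x l ih => exact (conf_cons_le _ _ _ _).trans (add_le_add ih le_rfl)

theorem xconf_snoc_le (w : List (Letter Q Sig)) (σ : Letter Q Sig) (t r : State Q) :
    xconf A (w ++ [σ]) r ≤ xconf A w t + letterWt A σ t r := by
  rw [← mwt_singleton]
  exact mwt_append_le ..

theorem exists_xconf_snoc (w : List (Letter Q Sig)) (σ : Letter Q Sig) (r : State Q) :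
    ∃ t, xconf A (w ++ [σ]) r = xconf A w t + letterWt A σ t r := by
  obtain ⟨t, ht⟩ := exists_mwt_append A w [σ] (init A) r
  exact ⟨t, by rw [← mwt_singleton]; exact ht⟩

/-- The configuration reached on the word of a path is that of the automaton, shifted by the weight
of the path. -/
theorem xconf_pathWord {l : List (Sig × Q)} (hl : pathWt A l ≠ ⊤) (r : State Q) :
    xconf A (pathWord A l) r =
      if base r = pathEnd A l ∧ reach r = reachOf A (l.map Prod.fst) then
        conf A (l.map Prod.fst) (inner r) + (pathWt A l).map fun c => -c
      else ⊤ := by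
  induction l generalizing r with
  | nil =>
    by_cases h : init A = r
    · subst h
      simp [xconf, pathWord, mwt, init, base, reach, inner, pathEnd, reachOf, conf, pathWt]
    · have h' : ¬ (base r = A.init ∧ reach r = {A.init}) := fun hr => h <| by
        have hi := inner_mem r
        rw [hr.2, mem_singleton] at hi
        exact state_ext hi.symm hr.1.symm hr.2.symm
      simp only [pathEnd, List.map_nil, reachOf, h', if_false]
      simp [xconf, pathWord, mwt, h]
  | cons x l ih =>
    obtain ⟨a, q⟩ := x
    rw [pathWt, ne_eq, WithTop.add_eq_top, not_or] at hl
    have ih' := ih hl.1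
    obtain ⟨β, hβ⟩ := WithTop.ne_top_iff_exists.1 hl.1
    obtain ⟨ω, hω⟩ := WithTop.ne_top_iff_exists.1 hl.2
    simp only at hω
    have hend : pathEnd A l ∈ reachOf A (l.map Prod.fst) :=
      mem_reachOf (ne_top_of_le_ne_top hl.1 (conf_pathEnd_le l))
    have hcalc : ∀ x y : WithTop ℤ, x + ((-β : ℤ) : WithTop ℤ) + (y + ((-ω : ℤ) : WithTop ℤ)) =
        x + y + ((-(β + ω) : ℤ) : WithTop ℤ) := fun x y => by
      rw [add_add_add_comm, ← WithTop.coe_add, neg_add]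
    have hneg : (pathWt A ((a, q) :: l)).map (fun c => -c) = ((-(β + ω) : ℤ) : WithTop ℤ) := by
      rw [pathWt, ← hβ, ← hω]; rfl
    rw [hneg]
    simp only [← hβ, WithTop.map_coe] at ih'
    simp only [pathWord, pathEnd_cons, List.map_cons, reachOf]
    split_ifs with hr
    · apply le_antisymm
      · obtain ⟨p, hp⟩ := exists_conf_cons (A := A) a (l.map Prod.fst) (inner r)
        rw [hp]
        by_cases hpt : conf A (l.map Prod.fst) p = ⊤
        · simp [hpt]
        refine (xconf_snoc_le _ _ ⟨(p, pathEnd A l, reachOf A (l.map Prod.fst)),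
          mem_reachOf hpt, hend⟩ r).trans ?_
        rw [ih', letterWt_std, if_pos ⟨rfl, rfl⟩, if_pos ⟨rfl, hr.1, hr.2⟩, ← hω, WithTop.map_coe,
          hcalc]
        exact le_rfl
      · obtain ⟨t, ht⟩ := exists_xconf_snoc (A := A) (pathWord A l) (.std (pathEnd A l) a q) r
        rw [ht, ih', letterWt_std]
        split_ifs with h1 h2
        · rw [← hω, WithTop.map_coe, hcalc]
          exact add_le_add (conf_cons_le _ _ _ _) le_rfl
        all_goals simp
    · obtain ⟨t, ht⟩ := exists_xconf_snoc (A := A) (pathWord A l) (.std (pathEnd A l) a q) r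
      rw [ht, ih', letterWt_std]
      split_ifs with h1 h2
      · exact absurd ⟨h2.2.1, by rw [h2.2.2, h1.2]⟩ hr
      all_goals simp

/-- A standard letter can be read only if its source is the current baseline component, so a finite
configuration forces the letters to chain into a path. -/
theorem exists_eq_pathWord {w : List (Letter Q Sig)} (hw : ∀ σ ∈ w, IsStd σ) {r : State Q}
    (hr : xconf A w r ≠ ⊤) : ∃ l, w = pathWord A l ∧ pathWt A l ≠ ⊤ := by
  induction w using List.reverseRecOn generalizing r with
  | nil => exact ⟨[], rfl, by simp [pathWt]⟩
  | append_singleton w σ ih =>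
    obtain ⟨t, ht⟩ := exists_xconf_snoc (A := A) w σ r
    rw [ht, ne_eq, WithTop.add_eq_top, not_or] at hr
    obtain ⟨l, rfl, hl⟩ := ih (fun τ hτ => hw τ (by simp [hτ])) hr.1
    obtain ⟨p, a, q, rfl⟩ := hw σ (by simp)
    have h1 := hr.1
    have h2 := hr.2
    rw [xconf_pathWord hl] at h1
    rw [letterWt_std] at h2
    split_ifs at h1 h2 with h3 h4
    · obtain rfl : p = pathEnd A l := h4.1.symm.trans h3.1
      refine ⟨(a, q) :: l, rfl, ?_⟩
      rw [pathWt, ne_eq, WithTop.add_eq_top, not_or]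
      refine ⟨hl, fun htop => h2 ?_⟩
      simp only at htop
      simp [htop]
    all_goals simp at h1 h2

omit [Fintype Q] in
theorem isStd_pathWord (l : List (Sig × Q)) : ∀ σ ∈ pathWord A l, IsStd σ := by
  induction l with
  | nil => simp [pathWord]
  | cons x l ih =>
    intro σ hσ
    rw [pathWord, List.mem_append, List.mem_singleton] at hσ
    rcases hσ with h | rfl
    · exact ih σ h
    · exact ⟨_, _, _, rfl⟩

theorem runWt_congr (w : List (Letter Q Sig)) {ρ ρ' : ℕ → State Q}
    (h : ∀ i ≤ w.length, ρ i = ρ' i) : runWt A w ρ = runWt A w ρ' := by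
  induction w generalizing ρ ρ' with
  | nil => rfl
  | cons σ w ih =>
    simp only [runWt]
    rw [h 0 (by simp), h 1 (by simp), ih fun i hi => h (i + 1) (by simpa using hi)]

theorem runWt_snoc (w : List (Letter Q Sig)) (σ : Letter Q Sig) (ρ : ℕ → State Q) :
    runWt A (w ++ [σ]) ρ = runWt A w ρ + letterWt A σ (ρ w.length) (ρ (w.length + 1)) := by
  induction w generalizing ρ with
  | nil => simp [runWt]
  | cons τ w ih => simp only [List.cons_append, runWt, ih, List.length_cons, add_assoc]

/-- All prefixes of the path have minimal weight. -/
def IsSeamless (A : WFA Q Sig) (l : List (Sig × Q)) : Prop :=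
  ∀ l', l' <:+ l → pathWt A l' = conf A (l'.map Prod.fst) (pathEnd A l')

/-- Optimal predecessors chosen backwards make every prefix optimal for its own end state. -/
theorem exists_isSeamless (v : List Sig) (q : Q) (h : conf A v q ≠ ⊤) :
    ∃ l : List (Sig × Q), l.map Prod.fst = v ∧ pathEnd A l = q ∧ IsSeamless A l := by
  induction v generalizing q with
  | nil =>
    have hq : q = A.init := by
      by_contra hne
      exact h (by simp [conf, hne])
    refine ⟨[], rfl, hq.symm, fun l' hl' => ?_⟩
    obtain rfl := List.suffix_nil.1 hl'
    simp [pathWt, conf, pathEnd]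
  | cons a v ih =>
    obtain ⟨p, hp⟩ := exists_conf_cons (A := A) a v q
    have h' := h
    rw [hp, ne_eq, WithTop.add_eq_top, not_or] at h'
    obtain ⟨l, rfl, rfl, hl⟩ := ih p h'.1
    refine ⟨(a, q) :: l, rfl, rfl, fun l' hl' => ?_⟩
    rcases List.suffix_cons_iff.1 hl' with rfl | hl'
    · rw [pathWt, hl l List.suffix_rfl]
      exact hp.symm
    · exact hl l' hl'

/-- Weights are relative to the baseline, so the baseline run has weight zero throughout. By
`xconf_pathWord`, minimality of the path's prefixes becomes seamlessness. -/
theorem hasSeamlessBaseline_pathWord {l : List (Sig × Q)} (hs : IsSeamless A l)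
    (hl : pathWt A l ≠ ⊤) : HasSeamlessBaseline A (pathWord A l) := by
  suffices ∃ ρ : ℕ → State Q, ρ 0 = init A ∧
      inner (ρ (pathWord A l).length) = pathEnd A l ∧
      base (ρ (pathWord A l).length) = pathEnd A l ∧
      reach (ρ (pathWord A l).length) = reachOf A (l.map Prod.fst) ∧
      runWt A (pathWord A l) ρ = 0 ∧ (∀ j ≤ (pathWord A l).length, IsBaseline (ρ j)) ∧
      ∀ j ≤ (pathWord A l).length,
        runWt A ((pathWord A l).take j) ρ = mwt A ((pathWord A l).take j) (init A) (ρ j) by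
    obtain ⟨ρ, h0, -, -, -, hw, hb, hm⟩ := this
    exact ⟨ρ, h0, by rw [hw]; simp, hb, hm⟩
  induction l with
  | nil =>
    refine ⟨fun _ => init A, rfl, rfl, rfl, rfl, rfl, fun _ _ => rfl, fun j _ => ?_⟩
    simp [pathWord, runWt, mwt]
  | cons x l ih =>
    obtain ⟨a, q⟩ := x
    have hl' := hl
    rw [pathWt, ne_eq, WithTop.add_eq_top, not_or] at hl'
    obtain ⟨ρ, h0, hi, hba, hre, hw, hb, hm⟩ :=
      ih (fun l' h => hs l' (h.trans (List.suffix_cons _ _))) hl'.1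
    have hq : q ∈ reachOf A (((a, q) :: l).map Prod.fst) :=
      mem_reachOf (ne_top_of_le_ne_top hl (conf_pathEnd_le ((a, q) :: l)))
    set n := (pathWord A l).length with hn
    set r : State Q := ⟨(q, q, reachOf A (((a, q) :: l).map Prod.fst)), hq, hq⟩ with hr
    have hlen : (pathWord A ((a, q) :: l)).length = n + 1 := by simp [pathWord, hn]
    have hcongr : ∀ w : List (Letter Q Sig), w.length ≤ n →
        runWt A w (Function.update ρ (n + 1) r) = runWt A w ρ := fun w hw' =>
      runWt_congr w fun i hi' => Function.update_of_ne (by omega) _ _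
    have hlast : letterWt A (.std (pathEnd A l) a q) (ρ n) r = 0 := by
      rw [letterWt_std, if_pos ⟨hba, rfl, by rw [hre]; rfl⟩, hi]
      obtain ⟨ω, hω⟩ := WithTop.ne_top_iff_exists.1 hl'.2
      simp only at hω
      change A.wt (pathEnd A l) a q + _ = 0
      rw [← hω, WithTop.map_coe, ← WithTop.coe_add]
      simp
    have hrun : runWt A (pathWord A ((a, q) :: l)) (Function.update ρ (n + 1) r) = 0 := by
      rw [pathWord, runWt_snoc, ← hn, hcongr _ le_rfl, hw, Function.update_self,
        Function.update_of_ne (by omega), hlast, add_zero]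
    refine ⟨Function.update ρ (n + 1) r, ?_, ?_, ?_, ?_, hrun, ?_, ?_⟩
    · rw [Function.update_of_ne (by omega), h0]
    · rw [hlen, Function.update_self]; rfl
    · rw [hlen, Function.update_self]; rfl
    · rw [hlen, Function.update_self]; rfl
    · intro j hj
      rw [hlen] at hj
      rcases Nat.lt_or_ge j (n + 1) with h | h
      · rw [Function.update_of_ne (by omega)]; exact hb j (by omega)
      · obtain rfl : j = n + 1 := by omega
        rw [Function.update_self]; rfl
    · intro j hj
      rw [hlen] at hj
      rcases Nat.lt_or_ge j (n + 1) with h | h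
      · rw [Function.update_of_ne (by omega), pathWord, List.take_append_of_le_length (by omega),
          hcongr _ (by simp [hn])]
        exact hm j (by omega)
      · obtain rfl : j = n + 1 := by omega
        rw [Function.update_self, List.take_of_length_le (by omega), hrun]
        have hx := xconf_pathWord hl r
        rw [xconf] at hx
        rw [hx, if_pos ⟨rfl, rfl⟩]
        change 0 = conf A _ (pathEnd A ((a, q) :: l)) + _
        rw [← hs _ List.suffix_rfl]
        obtain ⟨ω, hω⟩ := WithTop.ne_top_iff_exists.1 hl
        rw [← hω, WithTop.map_coe, ← WithTop.coe_add]
        simp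

end Paths

-- Dominant states and large potentials.

section Dominance

variable {Q : Type u} {Sig : Type v} [DecidableEq Q] [Fintype Q] [Fintype Sig] {A : WFA Q Sig}

/-- The height of a dominant state above any other state is the weight of a dominant state after a
word of standard letters. -/
theorem exists_std_potential_ge {w : List (Letter Q Sig)} (hw : ∀ σ ∈ w, IsBdd A (Lgen A) σ)
    {q m : State Q} (hd : IsDominant A (xconf A w) q) {vq vm : ℤ} (hvq : xconf A w q = vq)
    (hvm : xconf A w m = vm) :
    ∃ w' : List (Letter Q Sig), (∀ σ ∈ w', IsStd σ) ∧ HasSeamlessBaseline A w' ∧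
      (((vq - vm : ℤ) : WithTop ℤ) : WithBot (WithTop ℤ)) ≤ potential A w' := by
  obtain ⟨-, z, α, hz, hα, ⟨r, hr⟩, hlow⟩ := hd
  -- With threshold `vq + 1`, a state unreachable on `w` receives a weight above that of `q`, so
  -- flattening creates no new states below `q`.
  obtain ⟨w₀, hw₀, ha⟩ := flattenable hw (init A) ⟨q, by rw [xconf] at hvq; rw [hvq]; simp⟩ (vq + 1)
  have ha' : ∀ r, Approx (vq + 1) (xconf A w r) (xconf A w₀ r) := ha (init A) rfl rfl
  have hq := (ha' q).1 (by rw [hvq]; simp)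
  have hm := (ha' m).1 (by rw [hvm]; simp)
  rw [hvq] at hq
  rw [hvm] at hm
  obtain ⟨l, rfl, hl⟩ := exists_eq_pathWord hw₀ (r := q) (by rw [hq]; simp)
  have hx := xconf_pathWord hl
  obtain ⟨β, hβ⟩ := WithTop.ne_top_iff_exists.1 hl
  simp only [← hβ, WithTop.map_coe] at hx
  set v := l.map Prod.fst with hv
  rw [hx] at hq hm
  have hq' : base q = pathEnd A l ∧ reach q = reachOf A v := by
    by_contra h
    simp [if_neg h] at hq
  have hm' : base m = pathEnd A l ∧ reach m = reachOf A v := by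
    by_contra h
    simp [if_neg h] at hm
  rw [if_pos hq'] at hq
  rw [if_pos hm'] at hm
  have hadd : ∀ (x : WithTop ℤ) (y : ℤ), x + ((-β : ℤ) : WithTop ℤ) = y →
      x = ((y + β : ℤ) : WithTop ℤ) := by
    intro x y h
    cases x with
    | top => simp at h
    | coe x =>
      rw [← WithTop.coe_add, WithTop.coe_eq_coe] at h
      rw [WithTop.coe_eq_coe]
      omega
  have hq2 := hadd _ _ hq
  have hm2 := hadd _ _ hm
  -- The change of baseline: the same word of the automaton, now along a cheapest path to the inner
  -- state of `m`.
  obtain ⟨l', hl'v, hl'e, hl's⟩ := exists_isSeamless v (inner m) (by rw [hm2]; simp)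
  have hl'w : pathWt A l' = ((vm + β : ℤ) : WithTop ℤ) := by
    rw [hl's l' List.suffix_rfl, hl'v, hl'e, hm2]
  have hl' : pathWt A l' ≠ ⊤ := by rw [hl'w]; simp
  have hx' := xconf_pathWord hl'
  simp only [hl'w, WithTop.map_coe, hl'v, hl'e] at hx'
  have hmT : inner m ∈ reachOf A v := hm'.2 ▸ inner_mem m
  have heT : pathEnd A l ∈ reachOf A v := hm'.2 ▸ hm'.1 ▸ base_mem m
  set q' : State Q := ⟨(inner q, inner m, reachOf A v), hq'.2 ▸ inner_mem q, hmT⟩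
  have hcq' : xconf A (pathWord A l') q' = ((vq - vm : ℤ) : WithTop ℤ) := by
    rw [hx', if_pos ⟨rfl, rfl⟩]
    change conf A v (inner q) + _ = _
    rw [hq2, ← WithTop.coe_add, WithTop.coe_eq_coe]
    omega
  refine ⟨pathWord A l', isStd_pathWord l', hasSeamlessBaseline_pathWord hl's hl', ?_⟩
  rw [← hcq']
  suffices hdom : IsDominant A (xconf A (pathWord A l')) q' by
    classical
    rw [potential]
    apply Finset.le_sup (f := fun q => ((xconf A (pathWord A l') q : WithTop ℤ) :
      WithBot (WithTop ℤ)))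
    rw [Finset.mem_filter]
    exact ⟨mem_univ _, hdom⟩
  -- The jump letter returns to the old baseline component, where the old suffix applies. All
  -- weights have changed by the same constant, so the order of states is kept.
  refine ⟨by rw [hcq']; simp, .jump (inner m) (pathEnd A l) (reachOf A v) :: z, α, ?_, hα,
    ⟨r, ?_⟩, fun p hp r' => ?_⟩
  · intro σ hσ
    rcases List.mem_cons.1 hσ with rfl | hσ
    · exact Or.inr ⟨_, _, _, hmT, heT, rfl⟩
    · exact hz σ hσ
  · have h1 := mwt_append_le A [.jump (inner m) (pathEnd A l) (reachOf A v)] (z ++ [α]) q' q r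
    rw [mwt_singleton, letterWt_jump, if_pos ⟨rfl, rfl, hq'.1, hq'.2, rfl⟩, zero_add] at h1
    exact ne_top_of_le_ne_top hr h1
  · by_contra hfin
    obtain ⟨t, ht⟩ := mwt_cons A (.jump (inner m) (pathEnd A l) (reachOf A v)) (z ++ [α]) p r'
    rw [List.cons_append, ht, WithTop.add_eq_top, not_or, letterWt_jump] at hfin
    obtain ⟨hj, hfin⟩ := hfin
    split_ifs at hj with hj'
    · have hpc : xconf A (pathWord A l') p = conf A v (inner p) + ((-(vm + β) : ℤ) : WithTop ℤ) := by
        rw [hx', if_pos ⟨hj'.1, hj'.2.1⟩]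
      have htc : xconf A (pathWord A l) t = conf A v (inner p) + ((-β : ℤ) : WithTop ℤ) := by
        rw [hx, if_pos ⟨hj'.2.2.1, hj'.2.2.2.1⟩, hj'.2.2.2.2]
      rw [hpc, hcq'] at hp
      have hlt : xconf A (pathWord A l) t < vq := by
        rw [htc]
        cases h : conf A v (inner p) with
        | top => simp [h] at hp
        | coe c =>
          rw [h, ← WithTop.coe_add, WithTop.coe_lt_coe] at hp
          rw [← WithTop.coe_add, WithTop.coe_lt_coe]
          omega
      have hne : xconf A w t ≠ ⊤ := fun htop => by
        have h1 := ((ha' t).2 htop).trans_lt hlt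
        rw [WithTop.coe_lt_coe] at h1
        omega
      rw [(ha' t).1 hne, ← hvq] at hlt
      exact hfin (hlow t hlt r')
    · exact hj rfl

/-- The saturated set of a state. -/
def saturation (r : State Q) : Finset (State Q) :=
  univ.filter fun s => base s = base r ∧ reach s = reach r

theorem mem_saturation {r s : State Q} :
    s ∈ saturation r ↔ base s = base r ∧ reach s = reach r := by
  simp [saturation]

omit [Fintype Sig] in
theorem mpow_mwt_nil (n : ℕ) (s r : State Q) :
    mpow (mwt A []) n s r = if s = r then 0 else ⊤ := by
  rw [← mwt_pow]
  have h : (List.replicate n ([] : List (Letter Q Sig))).flatten = [] := by simp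
  rw [h, mwt]

omit [Fintype Sig] in
theorem mem_minStates_nil {r s : State Q} (hs : s ∈ saturation r) (n : ℕ) :
    s ∈ minStates (saturation r) (mpow (mwt A []) n) := by
  refine Finset.mem_filter.2 ⟨Finset.mem_filter.2 ⟨hs, ?_⟩, fun t _ => ?_⟩
  · simp [mpow_mwt_nil]
  · simp [mpow_mwt_nil]

-- Dominance requires a suffix that ends in a cactus letter. After a standard letter, the cactus
-- letter of the empty word fills this role, as every state of the saturated set has a zero loop on
-- it.
omit [Fintype Sig] in
theorem isStableCycle_nil (r : State Q) : IsStableCycle (saturation r) (mwt A []) := by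
  refine ⟨⟨(base r, base r, reach r), base_mem r, base_mem r⟩, ⟨⟨rfl, fun s => ?_⟩, ?_⟩, fun n =>
    ⟨mem_minStates_nil ?_ n, ?_⟩⟩
  · exact mem_saturation
  · intro s hs t ht
    have : s = t := by
      by_contra hne
      exact ht (by simp [mwt, hne])
    exact this ▸ hs
  · exact mem_saturation.2 ⟨rfl, rfl⟩
  · simp [mpow_mwt_nil]

omit [Fintype Sig] in
theorem stabWt_nil_ne_top (r : State Q) : stabWt (saturation r) (mwt A []) r r ≠ ⊤ := by
  have hr : r ∈ saturation r := by simp [saturation]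
  have hmin := mem_minStates_nil (A := A) hr (stabConst (Fintype.card (State Q)))
  have hg : IsGrounded (saturation r) (mwt A []) r r :=
    ⟨hr, hr, r, hmin, by simp [mpow_mwt_nil], by simp [mpow_mwt_nil]⟩
  rw [stabWt, if_pos hg]
  refine ne_top_of_le_ne_top (b := 0) (by simp) ((Finset.inf_le hmin).trans ?_)
  simp [mpow_mwt_nil]

/-- The lowest state from which a letter can be read is dominant. -/
theorem exists_isDominant {w : List (Letter Q Sig)} {σ : Letter Q Sig} (hσ : IsBdd A (Lgen A) σ)
    {r : State Q} (hr : xconf A (w ++ [σ]) r ≠ ⊤) :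
    ∃ q t, IsDominant A (xconf A w) q ∧ letterWt A σ q t ≠ ⊤ := by
  classical
  obtain ⟨q, hq, hmin⟩ := Finset.exists_min_image
    (univ.filter fun q => xconf A w q ≠ ⊤ ∧ ∃ t, letterWt A σ q t ≠ ⊤) (xconf A w) (by
      obtain ⟨t, ht⟩ := exists_xconf_snoc (A := A) w σ r
      rw [ht, ne_eq, WithTop.add_eq_top, not_or] at hr
      exact ⟨t, Finset.mem_filter.2 ⟨mem_univ _, hr.1, r, hr.2⟩⟩)
  simp only [Finset.mem_filter, mem_univ, true_and] at hq hmin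
  obtain ⟨hqf, t, ht⟩ := hq
  have hlow : ∀ p, xconf A w p < xconf A w q → ∀ r, letterWt A σ p r = ⊤ := by
    intro p hp r
    by_contra hne
    exact absurd (hmin p ⟨ne_top_of_lt hp, r, hne⟩) (not_le.2 hp)
  refine ⟨q, t, ⟨hqf, ?_⟩, ht⟩
  cases hσ with
  | std p a q₂ =>
    refine ⟨[.std p a q₂], .cactus (saturation t) [], ?_, ?_, ⟨t, ?_⟩, fun p' hp r' => ?_⟩
    · intro σ hσ
      rw [List.mem_singleton] at hσ
      exact hσ ▸ Or.inl (Or.inl (.std _ _ _))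
    · exact ⟨_, [], by simp, isStableCycle_nil t, by simp, rfl⟩
    · refine ne_top_of_le_ne_top ?_ (mwt_append_le A _ _ q t t)
      rw [mwt_singleton, mwt_singleton, letterWt_cactus, ne_eq, WithTop.add_eq_top, not_or]
      exact ⟨ht, stabWt_nil_ne_top t⟩
    · obtain ⟨s, hs⟩ := exists_mwt_append A [.std p a q₂] [.cactus (saturation t) []] p' r'
      rw [hs, mwt_singleton, hlow p' hp s, top_add]
  | cactus S' w' hw' hst hnd hd hl =>
    refine ⟨[], .cactus S' w', by simp, ⟨S', w', fun τ hτ => Or.inl (hw' τ hτ), hst, hl, rfl⟩,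
      ⟨t, ?_⟩, fun p hp r' => ?_⟩
    · rwa [List.nil_append, mwt_singleton]
    · rw [List.nil_append, mwt_singleton, hlow p hp r']

end Dominance

-- Ramsey numbers for triangles.

section RamseyTriangles

/-- Induction on the colours: the least vertex has many neighbours in one colour. Either two of them
are joined in that colour, or the colour disappears among them. -/
theorem exists_monochromatic_triangle {κ : Type*} [DecidableEq κ] (k : ℕ) :
    ∃ n, ∀ C : Finset κ, C.card ≤ k → ∀ V : Finset ℕ, n ≤ V.card → ∀ c : ℕ → ℕ → κ,
      (∀ i ∈ V, ∀ j ∈ V, i < j → c i j ∈ C) →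
      ∃ i ∈ V, ∃ j ∈ V, ∃ l ∈ V, i < j ∧ j < l ∧ c i j = c j l ∧ c i j = c i l := by
  induction k with
  | zero =>
    refine ⟨2, fun C hC V hV c hc => ?_⟩
    obtain rfl : C = ∅ := by simpa using hC
    obtain ⟨i, hi, j, hj, hij⟩ := Finset.one_lt_card.1 (show 1 < V.card by omega)
    rcases lt_or_gt_of_ne hij with h | h
    · exact absurd (hc i hi j hj h) (by simp)
    · exact absurd (hc j hj i hi h) (by simp)
  | succ k ih =>
    obtain ⟨n, hn⟩ := ih
    refine ⟨(k + 1) * n + 2, fun C hC V hV c hc => ?_⟩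
    have hne : V.Nonempty := Finset.card_pos.1 (by omega)
    have hv := V.min'_mem hne
    have hlt : ∀ i ∈ V.erase (V.min' hne), V.min' hne < i := fun i hi =>
      V.min'_lt_of_mem_erase_min' hne hi
    obtain ⟨y, hy, hcard⟩ := Finset.exists_lt_card_fiber_of_mul_lt_card_of_maps_to
      (s := V.erase (V.min' hne)) (t := C) (f := c (V.min' hne)) (n := n)
      (fun i hi => hc _ hv i (Finset.mem_of_mem_erase hi) (hlt i hi)) (by
        rw [Finset.card_erase_of_mem hv]
        have := Nat.mul_le_mul_right n hC
        omega)
    set U := (V.erase (V.min' hne)).filter fun i => c (V.min' hne) i = y with hU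
    have hUV : ∀ i ∈ U, i ∈ V ∧ V.min' hne < i ∧ c (V.min' hne) i = y := fun i hi => by
      rw [hU, Finset.mem_filter] at hi
      exact ⟨Finset.mem_of_mem_erase hi.1, hlt i hi.1, hi.2⟩
    by_cases h : ∃ i ∈ U, ∃ j ∈ U, i < j ∧ c i j = y
    · obtain ⟨i, hi, j, hj, hij, hcy⟩ := h
      obtain ⟨h1, h2, h3⟩ := hUV i hi
      obtain ⟨h4, -, h5⟩ := hUV j hj
      exact ⟨_, hv, i, h1, j, h4, h2, hij, h3.trans hcy.symm, h3.trans h5.symm⟩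
    · push Not at h
      obtain ⟨i, hi, j, hj, l, hl, hres⟩ := hn (C.erase y) (by
        rw [Finset.card_erase_of_mem hy]; omega) U (by omega) c fun i hi j hj hij =>
          Finset.mem_erase.2 ⟨h i hi j hj hij, hc i (hUV i hi).1 j (hUV j hj).1 hij⟩
      exact ⟨i, (hUV i hi).1, j, (hUV j hj).1, l, (hUV l hl).1, hres⟩

/-- `Ramsey` is an infimum, which is attained once the defining set is known to be non-empty. The
bound used for this plays no further role. -/
theorem ramsey_three_spec (k : ℕ) (c : {e : Finset (Fin (Ramsey k 3)) // e.card = 2} → Fin k) :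
    ∃ V : Finset (Fin (Ramsey k 3)), 3 ≤ V.card ∧
      ∀ e e', e.1 ⊆ V → e'.1 ⊆ V → c e = c e' := by
  suffices h : {R : ℕ | ∀ c : {e : Finset (Fin R) // e.card = 2} → Fin k,
      ∃ V : Finset (Fin R), 3 ≤ V.card ∧
        ∀ e e' : {e : Finset (Fin R) // e.card = 2}, e.1 ⊆ V → e'.1 ⊆ V → c e = c e'}.Nonempty by
    exact Nat.sInf_mem h c
  obtain ⟨n, hn⟩ := exists_monochromatic_triangle (κ := Option (Fin k)) k
  refine ⟨n, fun c => ?_⟩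
  have hpair : ∀ i j : ℕ, ∀ h : i < j ∧ j < n,
      ({⟨i, h.1.trans h.2⟩, ⟨j, h.2⟩} : Finset (Fin n)).card = 2 := fun i j h =>
    Finset.card_pair (by simpa using h.1.ne)
  obtain ⟨i, -, j, -, l, hl, hij, hjl, h1, h2⟩ := hn (univ.map Function.Embedding.some) (by simp)
    (Finset.range n) (by simp)
    (fun i j => if h : i < j ∧ j < n then some (c ⟨_, hpair i j h⟩) else none) (by
      intro i _ j hj hij
      rw [dif_pos ⟨hij, Finset.mem_range.1 hj⟩]
      simp)
  rw [Finset.mem_range] at hl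
  rw [dif_pos ⟨hij, hjl.trans hl⟩, dif_pos ⟨hjl, hl⟩, Option.some_inj] at h1
  rw [dif_pos ⟨hij, hjl.trans hl⟩, dif_pos ⟨hij.trans hjl, hl⟩, Option.some_inj] at h2
  set i' : Fin n := ⟨i, (hij.trans hjl).trans hl⟩
  set j' : Fin n := ⟨j, hjl.trans hl⟩
  set l' : Fin n := ⟨l, hl⟩
  have hij' : i' ≠ j' := Fin.ne_of_val_ne hij.ne
  have hil' : i' ≠ l' := Fin.ne_of_val_ne (hij.trans hjl).ne
  have hjl' : j' ≠ l' := Fin.ne_of_val_ne hjl.ne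
  have key : ∀ e : {e : Finset (Fin n) // e.card = 2}, e.1 ⊆ {i', j', l'} →
      c e = c ⟨{i', j'}, Finset.card_pair hij'⟩ := by
    rintro ⟨e, he⟩ hsub
    have hcases : e = {i', j'} ∨ e = {j', l'} ∨ e = {i', l'} := by
      obtain ⟨x, y, hxy, rfl⟩ := Finset.card_eq_two.1 he
      have hx := hsub (show x ∈ ({x, y} : Finset (Fin n)) by simp)
      have hy := hsub (show y ∈ ({x, y} : Finset (Fin n)) by simp)
      simp only [Finset.mem_insert, Finset.mem_singleton] at hx hy
      rcases hx with hx | hx | hx <;> rcases hy with hy | hy | hy <;>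
        first
        | exact absurd (hx.trans hy.symm) hxy
        | (rw [hx, hy]; simp)
        | (rw [hx, hy, Finset.pair_comm]; simp)
    rcases hcases with rfl | rfl | rfl
    · rfl
    · exact h1.symm
    · exact h2.symm
  refine ⟨{i', j', l'}, ?_, fun e e' he he' => (key e he).trans (key e' he').symm⟩
  rw [Finset.card_insert_of_notMem (by simp [hij', hil']), Finset.card_pair hjl']

theorem exists_ramsey_triple {κ : Type*} [Fintype κ] {k : ℕ} (hk : Fintype.card κ = k)
    (c : Fin (Ramsey k 3) → Fin (Ramsey k 3) → κ) :
    ∃ i j l, i < j ∧ j < l ∧ c i j = c j l := by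
  have hne : ∀ e : {e : Finset (Fin (Ramsey k 3)) // e.card = 2}, e.1.Nonempty := fun e =>
    Finset.card_pos.1 (by rw [e.2]; norm_num)
  obtain ⟨V, hV, hc⟩ := ramsey_three_spec k fun e =>
    Fintype.equivFinOfCardEq hk (c (e.1.min' (hne e)) (e.1.max' (hne e)))
  set x := V.orderEmbOfCardLe hV
  have hx : ∀ i, x i ∈ V := V.orderEmbOfCardLe_mem hV
  have h01 : x 0 < x 1 := x.strictMono (by decide)
  have h12 : x 1 < x 2 := x.strictMono (by decide)
  refine ⟨x 0, x 1, x 2, h01, h12, ?_⟩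
  have h := hc ⟨{x 0, x 1}, Finset.card_pair h01.ne⟩ ⟨{x 1, x 2}, Finset.card_pair h12.ne⟩
    (by simp [Finset.insert_subset_iff, hx]) (by simp [Finset.insert_subset_iff, hx])
  simpa [Finset.min'_pair, Finset.max'_pair, h01.le, h12.le] using h

end RamseyTriangles

-- Good positions with non-decreasing values.

section Sequences

theorem le_add_mul_of_step {f : ℕ → ℤ} {a b δ : ℕ}
    (hstep : ∀ t, a ≤ t → t < b → f (t + 1) ≤ f t + δ) {s t : ℕ} (has : a ≤ s) (hst : s ≤ t)
    (htb : t ≤ b) : f t ≤ f s + δ * ((t : ℤ) - s) := by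
  induction t, hst using Nat.le_induction with
  | base => simp
  | succ t hst ih =>
    have h1 := ih (by omega)
    have h2 := hstep t (by omega) (by omega)
    push_cast
    linarith

/-- First hitting times of increasing levels. -/
theorem exists_sequence_of_rise {f : ℕ → ℤ} {good : ℕ → Prop} {a b δ L e R : ℕ} (he : 1 ≤ e)
    (hstep : ∀ t, a ≤ t → t < b → f (t + 1) ≤ f t + δ)
    (hgood : ∀ t, a + L ≤ t → t ≤ b → good t ∨ ∃ l, 1 ≤ l ∧ l ≤ L ∧ f t < f (t - l))
    {s t : ℕ} (has : a ≤ s) (hst : s ≤ t) (htb : t ≤ b)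
    (hrise : f s + (δ * (L + R * e) : ℕ) < f t) :
    ∃ q : Fin R → ℕ, (∀ k, a ≤ q k ∧ q k ≤ b ∧ good (q k)) ∧
      ∀ k k', k < k' → q k + e ≤ q k' ∧ f (q k) ≤ f (q k') := by
  classical
  set lev : ℕ → ℤ := fun k => f s + (δ * (L + k * e) : ℕ) + 1 with hlev
  have hex : ∀ k : Fin R, ∃ q, s ≤ q ∧ q ≤ t ∧ lev k ≤ f q ∧
      ∀ τ, s ≤ τ → τ < q → f τ < lev k := by
    intro k
    have h : ∃ q, s ≤ q ∧ lev k ≤ f q := by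
      refine ⟨t, hst, ?_⟩
      have : δ * (L + k * e) ≤ δ * (L + R * e) := by gcongr; exact k.2.le
      simp only [hlev]
      omega
    refine ⟨Nat.find h, (Nat.find_spec h).1, Nat.find_min' h ⟨hst, ?_⟩, (Nat.find_spec h).2,
      fun τ hτ hlt => ?_⟩
    · have : δ * (L + k * e) ≤ δ * (L + R * e) := by gcongr; exact k.2.le
      simp only [hlev]
      omega
    · have := Nat.find_min h hlt
      push Not at this
      exact this hτ
  choose q hsq hqt hlq hmin using hex
  have hsL : ∀ k, s + L < q k := by
    intro k
    have h1 := le_add_mul_of_step hstep has (hsq k) ((hqt k).trans htb)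
    have h2 := hlq k
    simp only [hlev] at h2
    push_cast at h2
    by_contra hle
    have h3 : (δ : ℤ) * ((q k : ℤ) - s) ≤ δ * L :=
      mul_le_mul_of_nonneg_left (by omega) (by positivity)
    have h4 : (0 : ℤ) ≤ δ * (k * e) := by positivity
    rw [mul_add] at h2
    linarith
  refine ⟨q, fun k => ⟨has.trans (hsq k), (hqt k).trans htb, ?_⟩, fun k k' hk => ?_⟩
  -- At a first hitting time all earlier values since `s` are smaller, so the alternative to being
  -- good is impossible.
  · have hL := hsL k
    rcases hgood (q k) (by omega) ((hqt k).trans htb) with h | ⟨l, hl1, hl2, hl⟩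
    · exact h
    · have h1 := hmin k (q k - l) (by omega) (by omega)
      exact absurd (hlq k) (not_le.2 (hl.trans h1))
  · have hkk : (k : ℕ) + 1 ≤ k' := hk
    have hle : lev k + δ * e ≤ lev k' := by
      have : δ * (L + k * e) + δ * e ≤ δ * (L + k' * e) := by
        rw [← mul_add, add_assoc]
        gcongr
        calc (k : ℕ) * e + e = (k + 1) * e := by ring
          _ ≤ k' * e := by gcongr
      simp only [hlev]
      have h' : ((δ * (L + k * e) : ℕ) : ℤ) + δ * e ≤ ((δ * (L + k' * e) : ℕ) : ℤ) := by
        exact_mod_cast this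
      linarith
    have hde : (δ : ℤ) ≤ δ * e := by
      have : δ * 1 ≤ δ * e := by gcongr
      rw [mul_one] at this
      exact_mod_cast this
    have hδ : (0 : ℤ) ≤ δ := by positivity
    have hqq : q k ≤ q k' := by
      by_contra hlt
      have := hmin k (q k') (hsq k') (by omega)
      have := hlq k'
      omega
    have hL := hsL k
    have h1 := hmin k (q k - 1) (by omega) (by omega)
    have h2 := hstep (q k - 1) (by omega) (by have := (hqt k).trans htb; omega)
    rw [Nat.sub_add_cancel (by omega)] at h2
    have h3 := hlq k'
    refine ⟨?_, by omega⟩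
    have h4 := le_add_mul_of_step hstep (show a ≤ q k - 1 by omega)
      (show q k - 1 ≤ q k' by omega) ((hqt k').trans htb)
    by_contra hlt
    have h5 : (δ : ℤ) * ((q k' : ℤ) - (q k - 1 : ℕ)) ≤ δ * e :=
      mul_le_mul_of_nonneg_left (by omega) hδ
    omega

/-- Either a good position or a large value is found by descending. -/
theorem exists_good_or_high {f : ℕ → ℤ} {good : ℕ → Prop} {a b L : ℕ}
    (hgood : ∀ t, a + L ≤ t → t ≤ b → good t ∨ ∃ l, 1 ≤ l ∧ l ≤ L ∧ f t < f (t - l)) (k t : ℕ)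
    (hat : a + L + k * L ≤ t) (htb : t ≤ b) :
    (∃ t', t ≤ t' + k * L ∧ t' ≤ t ∧ good t') ∨
      ∃ t', t ≤ t' + k * L ∧ t' ≤ t ∧ f t + k ≤ f t' := by
  induction k with
  | zero => exact Or.inr ⟨t, by simp, le_rfl, by simp⟩
  | succ k ih =>
    rw [Nat.succ_mul] at hat ⊢
    rcases ih (by omega) with ⟨t', h1, h2, h3⟩ | ⟨t', h1, h2, h3⟩
    · exact Or.inl ⟨t', by omega, h2, h3⟩
    · rcases hgood t' (by omega) (by omega) with h | ⟨l, hl1, hl2, hl⟩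
      · exact Or.inl ⟨t', by omega, h2, h⟩
      · exact Or.inr ⟨t' - l, by omega, by omega, by push_cast; omega⟩

/-- If `f` rises by more than `A` somewhere, first hitting times of levels serve. Otherwise, as `f a
≤ f b`, all values lie within `A` of `f a`. Then stepping back from a position that is not good to a
larger value can be repeated only boundedly often, so every long window has a good position, and the
pigeonhole principle supplies `R` of them with equal value. -/
theorem exists_sequence {f : ℕ → ℤ} {good : ℕ → Prop} {a b δ L e R A : ℕ} (he : 1 ≤ e)
    (hA : A = δ * (L + R * e)) (hab : f a ≤ f b)
    (hstep : ∀ t, a ≤ t → t < b → f (t + 1) ≤ f t + δ)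
    (hgood : ∀ t, a + L ≤ t → t ≤ b → good t ∨ ∃ l, 1 ≤ l ∧ l ≤ L ∧ f t < f (t - l))
    (hlen : a + L + R * (2 * A + 1) * (2 * A * L + e) ≤ b) :
    ∃ q : Fin R → ℕ, (∀ k, a ≤ q k ∧ q k ≤ b ∧ good (q k)) ∧
      ∀ k k', k < k' → q k + e ≤ q k' ∧ f (q k) ≤ f (q k') := by
  by_cases hrise : ∃ s t, a ≤ s ∧ s ≤ t ∧ t ≤ b ∧ f s + A < f t
  · obtain ⟨s, t, has, hst, htb, hlt⟩ := hrise
    exact exists_sequence_of_rise he hstep hgood has hst htb (hA ▸ hlt)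
  push Not at hrise
  have hwin : ∀ j < R * (2 * A + 1), ∃ p, a + L + j * (2 * A * L + e) ≤ p ∧
      p ≤ a + L + j * (2 * A * L + e) + 2 * A * L ∧ p ≤ b ∧ good p := by
    intro j hj
    have hjb : (j + 1) * (2 * A * L + e) ≤ R * (2 * A + 1) * (2 * A * L + e) := by gcongr; omega
    rw [Nat.succ_mul] at hjb
    set t := a + L + j * (2 * A * L + e) + 2 * A * L with ht
    rcases exists_good_or_high hgood (2 * A) t (by omega) (by omega) with
      ⟨t', h1, h2, h3⟩ | ⟨t', h1, h2, h3⟩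
    · exact ⟨t', by omega, by omega, by omega, h3⟩
    · rcases hgood t' (by omega) (by omega) with h | ⟨l, hl1, hl2, hl⟩
      · exact ⟨t', by omega, by omega, by omega, h⟩
      -- After `2 * A + 1` steps back the value would exceed `f t + 2 * A`, whereas it is at most `f
      -- a + A ≤ f b + A ≤ f t + 2 * A`.
      · have h4 := hrise a (t' - l) le_rfl (by omega) (by omega)
        have h5 := hrise t b (by omega) (by omega) le_rfl
        push_cast at h3
        omega
  choose! p hp1 hp2 hpb hpg using hwin
  have hmono : ∀ j j', j < j' → j' < R * (2 * A + 1) → p j + e ≤ p j' := by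
    intro j j' hjj hj'
    have h1 : (j + 1) * (2 * A * L + e) ≤ j' * (2 * A * L + e) := by gcongr; omega
    rw [Nat.succ_mul] at h1
    have h2 := hp2 j (by omega)
    have h3 := hp1 j' hj'
    omega
  obtain ⟨y, -, hy⟩ := Finset.exists_le_card_fiber_of_mul_le_card_of_maps_to
    (s := Finset.range (R * (2 * A + 1))) (t := Finset.Icc (f a - A) (f a + A))
    (f := fun j => f (p j)) (n := R) (by
      intro j hj
      rw [Finset.mem_range] at hj
      have h1 := hp1 j hj
      have h2 := hpb j hj
      have h4 := hrise a (p j) le_rfl (by omega) (by omega)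
      have h5 := hrise (p j) b (by omega) (by omega) le_rfl
      rw [Finset.mem_Icc]
      omega) ⟨f a, by simp⟩ (by
      rw [Int.card_Icc, Finset.card_range, mul_comm]
      gcongr
      omega)
  set U := (Finset.range (R * (2 * A + 1))).filter fun j => f (p j) = y
  set x := U.orderEmbOfCardLe hy
  have hx : ∀ i, x i < R * (2 * A + 1) ∧ f (p (x i)) = y := fun i => by
    have h := Finset.mem_filter.1 (U.orderEmbOfCardLe_mem hy i)
    exact ⟨Finset.mem_range.1 h.1, h.2⟩
  refine ⟨fun k => p (x k), fun k => ⟨?_, hpb _ (hx k).1, hpg _ (hx k).1⟩, fun k k' hk =>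
    ⟨hmono _ _ (x.strictMono hk) (hx k').1, by rw [(hx k).2, (hx k').2]⟩⟩
  have := hp1 _ (hx k).1
  change a ≤ p (x k)
  omega

end Sequences

-- Arithmetic of the recursive bounds.

section Bounds

variable (N W H i₀ : ℕ)

/-- The length of the blocks considered at depth `d` with `i` independent runs. -/
def blockLen (d i : ℕ) : ℕ :=
  lenF N W H i₀ d 1 * lenF N W H i₀ (d + 1) (i + 1) *
    (Ramsey (typF N W H i₀ (d + 1) i) 3 + 2) ^ (2 * ampF N W H i₀ (d + 1) i + 1)

/-- The gap between independent runs at depth `d` with `i` independent runs. -/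
def runGap (d i : ℕ) : ℕ :=
  (4 * N * stabConst N + 2) * maxF N W H i₀ d * blockLen N W H i₀ d i + H +
    2 * covF N W H i₀ (d + 1) i + 1

variable {N W H i₀}

theorem lenF_succ {i : ℕ} (hi : i ≤ N) (d : ℕ) :
    lenF N W H i₀ (d + 1) i = 32 * stabConst N ^ 2 * blockLen N W H i₀ d i := by
  rw [lenF, if_pos hi, blockLen]
  ring

theorem stabConst_pos (hN : 1 ≤ N) : 0 < stabConst N := by
  rw [stabConst]
  positivity

theorem le_stabConst (N : ℕ) : N ≤ stabConst N :=
  Nat.le_mul_of_pos_right N N.factorial_pos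

theorem lenF_pos (hN : 1 ≤ N) (d i : ℕ) : 0 < lenF N W H i₀ d i := by
  induction d generalizing i with
  | zero => simp [lenF]
  | succ d ih =>
    suffices ∀ k i, N + 1 ≤ i + k → 0 < lenF N W H i₀ (d + 1) i from this (N + 1) i (by omega)
    intro k
    induction k with
    | zero =>
      intro i hi
      rw [lenF, if_neg (by omega)]
      exact one_pos
    | succ k ihk =>
      intro i hi
      rw [lenF]
      split_ifs
      · have h1 := stabConst_pos hN
        have h2 := ih 1
        have h3 := ihk (i + 1) (by omega)
        positivity
      · exact one_pos

theorem blockLen_pos (hN : 1 ≤ N) (d i : ℕ) : 0 < blockLen N W H i₀ d i := by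
  have h1 := lenF_pos (W := W) (H := H) (i₀ := i₀) hN d 1
  have h2 := lenF_pos (W := W) (H := H) (i₀ := i₀) hN (d + 1) (i + 1)
  rw [blockLen]
  positivity

theorem blockLen_le_lenF (hN : 1 ≤ N) {i : ℕ} (hi : i ≤ N) (d : ℕ) :
    blockLen N W H i₀ d i ≤ lenF N W H i₀ (d + 1) i := by
  have h1 := stabConst_pos hN
  rw [lenF_succ hi]
  exact Nat.le_mul_of_pos_left _ (by positivity)

theorem lenF_succ_le (hN : 1 ≤ N) (d i : ℕ) :
    lenF N W H i₀ (d + 1) (i + 1) ≤ lenF N W H i₀ (d + 1) i := by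
  by_cases hi : i ≤ N
  · refine le_trans ?_ (blockLen_le_lenF hN hi d)
    rw [blockLen, mul_right_comm]
    have h1 := lenF_pos (W := W) (H := H) (i₀ := i₀) hN d 1
    exact Nat.le_mul_of_pos_left _ (by positivity)
  · rw [lenF, if_neg (by omega), lenF, if_neg hi]

theorem blockLen_succ_le (hN : 1 ≤ N) {d i : ℕ} (hi : i < N) :
    blockLen N W H i₀ d (i + 1) ≤ lenF N W H i₀ d 1 * lenF N W H i₀ (d + 1) (i + 1) :=
  (blockLen_le_lenF hN hi d).trans (Nat.le_mul_of_pos_left _ (lenF_pos hN d 1))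

/-- This is what the recursion of `covF` provides: a state farther than the covering radius from all
runs, traced back over a block of the next level, loses at most twice the drift and still keeps the
gap required among one more run. -/
theorem runGap_succ_add_le (hN : 1 ≤ N) {d i : ℕ} (hi : i < N) :
    runGap N W H i₀ d (i + 1) + 2 * maxF N W H i₀ d * blockLen N W H i₀ d (i + 1) ≤
      covF N W H i₀ (d + 1) i + 1 := by
  have hcov : covF N W H i₀ (d + 1) i = 8 * stabConst N ^ 2 * (maxF N W H i₀ d *
      lenF N W H i₀ d 1 * lenF N W H i₀ (d + 1) (i + 1) + covF N W H i₀ (d + 1) (i + 1) + H) := by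
    rw [covF, if_pos hi]
  have h1 := blockLen_succ_le (W := W) (H := H) (i₀ := i₀) (d := d) hN hi
  have h2 := stabConst_pos hN
  have h3 := le_stabConst N
  rw [hcov, runGap]
  set m := stabConst N
  have h4 : 4 * N * m + 4 ≤ 8 * m ^ 2 := by nlinarith
  have h5 : 2 ≤ 8 * m ^ 2 := by nlinarith
  have h6 : (4 * N * m + 4) * (maxF N W H i₀ d * blockLen N W H i₀ d (i + 1)) ≤
      8 * m ^ 2 * (maxF N W H i₀ d * (lenF N W H i₀ d 1 * lenF N W H i₀ (d + 1) (i + 1))) := by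
    gcongr
  have h7 : 2 * covF N W H i₀ (d + 1) (i + 1) ≤ 8 * m ^ 2 * covF N W H i₀ (d + 1) (i + 1) := by
    gcongr
  have h8 : 1 * H ≤ 8 * m ^ 2 * H := by
    gcongr
    omega
  linarith

theorem runGap_succ_le (hN : 1 ≤ N) {d i : ℕ} (hi : i < N) :
    runGap N W H i₀ d (i + 1) ≤ runGap N W H i₀ d i := by
  have h1 := runGap_succ_add_le (W := W) (H := H) (i₀ := i₀) (d := d) hN hi
  have h2 : covF N W H i₀ (d + 1) i + 1 ≤ runGap N W H i₀ d i := by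
    rw [runGap]
    omega
  exact (Nat.le_add_right _ _).trans (h1.trans h2)

/-- The oscillation bound `A` is quadratic, and this lets it be absorbed by the power with exponent
`ampF` in `lenF`. -/
theorem two_mul_sq_lt_two_pow (x : ℕ) : 2 * (2 * x ^ 2) + 1 ≤ 2 ^ (32 * x) := by
  have h1 : 2 * x + 1 ≤ 2 ^ (2 * x) := Nat.lt_two_pow_self
  calc 2 * (2 * x ^ 2) + 1 ≤ (2 * x + 1) ^ 2 := by nlinarith
    _ ≤ (2 ^ (2 * x)) ^ 2 := by gcongr
    _ = 2 ^ (4 * x) := by rw [← pow_mul]; congr 1; ring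
    _ ≤ 2 ^ (32 * x) := by gcongr <;> omega

/-- The blocks are long enough for `exists_sequence`. -/
theorem length_le_blockLen (hN : 1 ≤ N) {d i e L R A : ℕ} (hi : i ≤ N)
    (he : e ≤ lenF N W H i₀ d 1)
    (hL : L = lenF N W H i₀ d 1 * lenF N W H i₀ (d + 1) (i + 1))
    (hR : R = Ramsey (typF N W H i₀ (d + 1) i) 3)
    (hA : A = (H + maxF N W H i₀ d) * (L + R * e)) :
    L + R * (2 * A + 1) * (2 * A * L + e) ≤ blockLen N W H i₀ d i := by
  have hm := stabConst_pos hN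
  have hΛ := lenF_pos (W := W) (H := H) (i₀ := i₀) hN d 1
  have hΛ' := lenF_pos (W := W) (H := H) (i₀ := i₀) hN (d + 1) (i + 1)
  have hamp : ampF N W H i₀ (d + 1) i = 32 * stabConst N ^ 2 * (H + 2 * maxF N W H i₀ d) *
      (R + lenF N W H i₀ (d + 1) (i + 1) + lenF N W H i₀ d 1) := by
    rw [ampF, if_pos hi, ← hR]
  rw [blockLen, ← hR, hamp, ← hL]
  set Λ := lenF N W H i₀ d 1
  set Λ' := lenF N W H i₀ (d + 1) (i + 1)
  set δ := H + 2 * maxF N W H i₀ d with hδ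
  set P := R + Λ' + Λ with hP
  have heL : e ≤ L := he.trans (hL ▸ Nat.le_mul_of_pos_right _ hΛ')
  have hA2 : A ≤ 2 * (δ * P) ^ 2 := by
    have h1 : L ≤ P ^ 2 := by rw [hL, pow_two]; gcongr <;> omega
    have h2 : R * e ≤ P ^ 2 := by rw [pow_two]; gcongr <;> omega
    have h3 : δ ≤ δ ^ 2 := Nat.le_self_pow two_ne_zero δ
    calc A ≤ δ * (P ^ 2 + P ^ 2) := by rw [hA]; gcongr; omega
      _ ≤ δ ^ 2 * (P ^ 2 + P ^ 2) := by gcongr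
      _ = 2 * (δ * P) ^ 2 := by ring
  have hpow : 2 * A + 1 ≤ 2 ^ (32 * stabConst N ^ 2 * δ * P) :=
    calc 2 * A + 1 ≤ 2 * (2 * (δ * P) ^ 2) + 1 := by gcongr
      _ ≤ 2 ^ (32 * (δ * P)) := two_mul_sq_lt_two_pow _
      _ ≤ 2 ^ (32 * stabConst N ^ 2 * δ * P) := by
        refine Nat.pow_le_pow_right (by norm_num) ?_
        rw [mul_assoc _ δ P]
        gcongr
        exact Nat.le_mul_of_pos_right _ (by positivity)
  set E := 32 * stabConst N ^ 2 * δ * P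
  calc L + R * (2 * A + 1) * (2 * A * L + e)
      ≤ L * 1 + R * (2 * A + 1) * (2 * A * L + L) := by gcongr; omega
    _ ≤ L * (2 * A + 1) ^ 2 + R * (2 * A + 1) * (2 * A * L + L) := by
        gcongr
        exact Nat.one_le_pow _ _ (by omega)
    _ = L * ((2 * A + 1) ^ 2 * (R + 1)) := by ring
    _ ≤ L * ((2 ^ E) ^ 2 * (R + 2)) := by gcongr; omega
    _ ≤ L * (((R + 2) ^ E) ^ 2 * (R + 2)) := by gcongr; omega
    _ = L * (R + 2) ^ (2 * E + 1) := by rw [pow_succ (R + 2) (2 * E), pow_mul' (R + 2) 2 E]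

theorem maxF_le_succ (hN : 1 ≤ N) (d : ℕ) : maxF N W H i₀ d ≤ maxF N W H i₀ (d + 1) := by
  have h1 := stabConst_pos hN
  have h2 := lenF_pos (W := W) (H := H) (i₀ := i₀) hN (d + 1) i₀
  calc maxF N W H i₀ d = 1 * maxF N W H i₀ d * 1 := by ring
    _ ≤ 2 * stabConst N * maxF N W H i₀ d * lenF N W H i₀ (d + 1) i₀ := by
      gcongr
      · omega
      · omega
    _ = maxF N W H i₀ (d + 1) := by rw [maxF]

theorem maxF_mono (hN : 1 ≤ N) : Monotone (maxF N W H i₀) :=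
  monotone_nat_of_le_succ (maxF_le_succ hN)

end Bounds

-- Abstract configuration sequences, runs and clusters.

/-- The trace of the configurations along a word: which states have finite weight, their weights, the
depths of the letters, and the minimal weight. -/
structure ConfigSeq (S : Type u) (n H : ℕ) (mx : ℕ → ℕ) where
  fin : ℕ → S → Prop
  val : ℕ → S → ℤ
  dep : ℕ → ℕ
  low : ℕ → ℤ
  back : ∀ t < n, ∀ r, fin (t + 1) r → ∃ s, fin t s ∧ |val (t + 1) r - val t s| ≤ mx (dep t)
  low_le : ∀ t ≤ n, ∀ s, fin t s → low t ≤ val t s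
  exists_low : ∀ t ≤ n, ∃ s, fin t s ∧ val t s = low t
  rise : ∀ t < n, low (t + 1) ≤ low t + (H + mx (dep t) : ℕ)

namespace ConfigSeq

variable {S : Type u} {n H : ℕ} {mx : ℕ → ℕ} (T : ConfigSeq S n H mx)

/-- A run along the positions from `a` to `b`. -/
def IsRun (D : ℕ) (ρ : ℕ → S) (a b : ℕ) : Prop :=
  (∀ t, a ≤ t → t ≤ b → T.fin t (ρ t)) ∧
    ∀ t, a ≤ t → t < b → |T.val (t + 1) (ρ (t + 1)) - T.val t (ρ t)| ≤ mx D

variable {T}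

theorem exists_run (hmx : Monotone mx) {a t D : ℕ} (hat : a ≤ t) (ht : t ≤ n)
    (hd : ∀ τ, a ≤ τ → τ < t → T.dep τ ≤ D) {s : S} (hs : T.fin t s) :
    ∃ ρ : ℕ → S, ρ t = s ∧ T.IsRun D ρ a t := by
  induction t, hat using Nat.le_induction generalizing s with
  | base =>
    refine ⟨fun _ => s, rfl, fun t h1 h2 => ?_, fun t h1 h2 => by omega⟩
    obtain rfl : t = a := by omega
    exact hs
  | succ t hat ih =>
    obtain ⟨r, hr, hrs⟩ := T.back t (by omega) s hs
    obtain ⟨ρ, rfl, h1, h2⟩ := ih (by omega) (fun τ h1 h2 => hd τ h1 (by omega)) hr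
    refine ⟨Function.update ρ (t + 1) s, Function.update_self .., fun τ h3 h4 => ?_,
      fun τ h3 h4 => ?_⟩
    · rcases Nat.lt_or_ge τ (t + 1) with h | h
      · rw [Function.update_of_ne (by omega)]
        exact h1 τ h3 (by omega)
      · obtain rfl : τ = t + 1 := by omega
        rwa [Function.update_self]
    · rw [Function.update_of_ne (show τ ≠ t + 1 by omega)]
      rcases Nat.lt_or_ge τ t with h | h
      · rw [Function.update_of_ne (by omega)]
        exact h2 τ h3 h
      · obtain rfl : τ = t := by omega
        rw [Function.update_self]
        exact hrs.trans (by exact_mod_cast hmx (hd τ h3 (by omega)))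

theorem IsRun.mono {D : ℕ} {ρ : ℕ → S} {a b a' b' : ℕ} (h : T.IsRun D ρ a b) (ha : a ≤ a')
    (hb : b' ≤ b) : T.IsRun D ρ a' b' :=
  ⟨fun t h1 h2 => h.1 t (by omega) (by omega), fun t h1 h2 => h.2 t (by omega) (by omega)⟩

theorem IsRun.abs_sub_le {D : ℕ} {ρ : ℕ → S} {a b : ℕ} (h : T.IsRun D ρ a b) {t t' : ℕ}
    (hat : a ≤ t) (htt : t ≤ t') (htb : t' ≤ b) :
    |T.val t' (ρ t') - T.val t (ρ t)| ≤ mx D * ((t' : ℤ) - t) := by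
  induction t', htt using Nat.le_induction with
  | base => simp
  | succ t' htt ih =>
    have h1 := ih (by omega)
    have h2 := h.2 t' (by omega) (by omega)
    push_cast
    rw [abs_le] at *
    constructor <;> linarith

theorem IsRun.abs_sub_le_length {D : ℕ} {ρ : ℕ → S} {a b : ℕ} (h : T.IsRun D ρ a b) {t t' : ℕ}
    (hat : a ≤ t) (htb : t ≤ b) (hat' : a ≤ t') (htb' : t' ≤ b) :
    |T.val t' (ρ t') - T.val t (ρ t)| ≤ (mx D * (b - a) : ℕ) := by
  wlog htt : t ≤ t' generalizing t t'
  · rw [abs_sub_comm]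
    exact this hat' htb' hat htb (by omega)
  refine (h.abs_sub_le hat htt htb').trans ?_
  push_cast [Nat.cast_sub (hat.trans htb)]
  exact mul_le_mul_of_nonneg_left (by omega) (by positivity)

variable (T)

/-- `t₁ < t₂ < t₃` delimit a separated repeating infix of depth `D`. -/
structure IsSepRep [Fintype S] (len : ℕ → ℕ) (D t₁ t₂ t₃ : ℕ) : Prop where
  lt₁₂ : t₁ < t₂
  lt₂₃ : t₂ < t₃
  dep_le : ∀ t, t₁ ≤ t → t < t₃ → T.dep t ≤ D
  dep_eq : ∃ t, t₁ ≤ t ∧ t < t₂ ∧ T.dep t = D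
  short : stabConst (Fintype.card S) * (t₂ - t₁) ≤ len (D + 1)
  fin₂ : ∀ s, T.fin t₂ s ↔ T.fin t₁ s
  fin₃ : ∀ s, T.fin t₃ s ↔ T.fin t₁ s
  parts : ∃ (ℓ : ℕ) (V : Fin ℓ → Set S),
    (∀ j, (V j).Nonempty) ∧ (Pairwise fun i j => Disjoint (V i) (V j)) ∧
    (⋃ j, V j) = {s | T.fin t₁ s} ∧
    (∀ i j : Fin ℓ, (i : ℕ) + 1 = j → ∀ s ∈ V i, ∀ s' ∈ V j, ∀ t ∈ [t₁, t₂, t₃],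
      T.val t s + (4 * Fintype.card S * stabConst (Fintype.card S) * (mx D * (t₃ - t₁)) + H : ℕ) <
        T.val t s') ∧
    ∀ j, ∃ kx ky : ℤ, kx.sign = ky.sign ∧ ∀ s ∈ V j,
      T.val t₂ s = T.val t₁ s + kx ∧ T.val t₃ s = T.val t₂ s + ky
  low₁₂ : T.low t₁ ≤ T.low t₂
  low₂₃ : T.low t₂ ≤ T.low t₃
  low_iff : T.low t₁ = T.low t₂ ↔ T.low t₂ = T.low t₃

variable {ι : Type} (ρ : ι → ℕ → S) (c : ℕ)

/-- The state `s` is covered by the run `j` at position `t`. -/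
def Near (t : ℕ) (s : S) (j : ι) : Prop :=
  T.fin t s ∧ |T.val t s - T.val t (ρ j t)| ≤ c

open Classical in
/-- The position of `s` relative to the run `j`, if it is covered by it. -/
def code (t : ℕ) (s : S) (j : ι) : Fin (2 * c + 2) :=
  if h : T.Near ρ c t s j then
    ⟨(T.val t s - T.val t (ρ j t) + c).toNat, by have := abs_le.1 h.2; omega⟩
  else Fin.last _

variable {T ρ c}

/-- The last code is reserved for uncovered pairs and the others record the signed offset shifted by
`c`, so a common code transfers both coverage and offset. -/
theorem near_of_code_eq {t t' : ℕ} {s : S} {j : ι} (h : T.code ρ c t s j = T.code ρ c t' s j)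
    (hn : T.Near ρ c t s j) :
    T.Near ρ c t' s j ∧ T.val t s - T.val t (ρ j t) = T.val t' s - T.val t' (ρ j t') := by
  have h1 := abs_le.1 hn.2
  by_cases hn' : T.Near ρ c t' s j
  · have h2 := abs_le.1 hn'.2
    rw [code, code, dif_pos hn, dif_pos hn', Fin.mk.injEq] at h
    exact ⟨hn', by omega⟩
  · rw [code, code, dif_pos hn, dif_neg hn', Fin.ext_iff, Fin.val_last] at h
    simp only at h
    omega

section Separated

variable {D a b Γ : ℕ} (hrun : ∀ j, T.IsRun D (ρ j) a b)
  (hgap : ∀ j k, j ≠ k → ∀ t, a ≤ t → t ≤ b →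
    (Γ : ℤ) ≤ |T.val t (ρ j t) - T.val t (ρ k t)|)

include hrun hgap

/-- Runs that are far apart keep their order. -/
theorem order_transfer (hΓ : 2 * (mx D * (b - a)) + 2 * c < Γ) {j k : ι} {t t' : ℕ}
    (hat : a ≤ t) (htb : t ≤ b) (hat' : a ≤ t') (htb' : t' ≤ b)
    (h : T.val t (ρ j t) + Γ ≤ T.val t (ρ k t)) :
    T.val t' (ρ j t') + Γ ≤ T.val t' (ρ k t') := by
  have hjk : j ≠ k := by
    rintro rfl
    omega
  have h1 := abs_le.1 ((hrun j).abs_sub_le_length hat htb hat' htb')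
  have h2 := abs_le.1 ((hrun k).abs_sub_le_length hat htb hat' htb')
  rcases le_abs.1 (hgap j k hjk t' hat' htb') with h3 | h3 <;> omega

/-- The lowest states at any two positions are covered by the same run. -/
theorem near_lowest (hΓ : 2 * (mx D * (b - a)) + 2 * c < Γ) (hbn : b ≤ n) {j : ι} {t t' : ℕ}
    (hat : a ≤ t) (htb : t ≤ b) (hat' : a ≤ t') (htb' : t' ≤ b)
    (hcov : ∀ s, T.fin t' s → ∃ j, T.Near ρ c t' s j) {s s' : S} (hs : T.Near ρ c t s j)
    (hlow : T.val t s = T.low t) (hs' : T.fin t' s') (hlow' : T.val t' s' = T.low t') :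
    T.Near ρ c t' s' j := by
  obtain ⟨k, hk⟩ := hcov s' hs'
  by_cases hjk : j = k
  · exact hjk ▸ hk
  exfalso
  have h1 := abs_le.1 hs.2
  have h2 := abs_le.1 hk.2
  have h3 := T.low_le t (by omega) _ ((hrun k).1 t hat htb)
  have h4 := T.low_le t' (by omega) _ ((hrun j).1 t' hat' htb')
  rcases le_abs.1 (hgap j k hjk t hat htb) with h5 | h5
  · omega
  · have h6 := order_transfer hrun hgap hΓ hat htb hat' htb' (j := j) (k := k) (by omega)
    omega

/-- Unchanged offsets make the states near one run move rigidly with it, so these clusters are the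
parts. The gap `Γ` exceeds the required separation together with the drift of two runs and the radii
of two clusters, which keeps the parts disjoint and in order. -/
theorem isSepRep_of_code_eq [Fintype S] [Fintype ι] {len : ℕ → ℕ} {t₁ t₂ t₃ : ℕ}
    (hΓ : (4 * Fintype.card S * stabConst (Fintype.card S) + 2) * mx D * (b - a) + H + 2 * c + 1 ≤ Γ)
    (hbn : b ≤ n) (hat : a ≤ t₁) (lt₁₂ : t₁ < t₂) (lt₂₃ : t₂ < t₃) (htb : t₃ ≤ b)
    (hdep : ∀ t, a ≤ t → t < b → T.dep t ≤ D) (hdep' : ∃ t, t₁ ≤ t ∧ t < t₂ ∧ D ≤ T.dep t)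
    (hlen : stabConst (Fintype.card S) * (b - a) ≤ len (D + 1))
    (low₁₂ : T.low t₁ ≤ T.low t₂) (low₂₃ : T.low t₂ ≤ T.low t₃)
    (hcov : ∀ t ∈ [t₁, t₂, t₃], ∀ s, T.fin t s → ∃ j, T.Near ρ c t s j)
    (hcode₁₂ : ∀ s j, T.code ρ c t₁ s j = T.code ρ c t₂ s j)
    (hcode₂₃ : ∀ s j, T.code ρ c t₂ s j = T.code ρ c t₃ s j)
    (hsign : ∀ j, SignType.sign (T.val t₂ (ρ j t₂) - T.val t₁ (ρ j t₁)) =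
      SignType.sign (T.val t₃ (ρ j t₃) - T.val t₂ (ρ j t₂))) :
    T.IsSepRep len D t₁ t₂ t₃ := by
  simp only [List.mem_cons, List.not_mem_nil, or_false, forall_eq_or_imp, forall_eq] at hcov
  obtain ⟨hcov₁, hcov₂, hcov₃⟩ := hcov
  have hgapΓ : 4 * Fintype.card S * stabConst (Fintype.card S) * (mx D * (t₃ - t₁)) +
      2 * (mx D * (b - a)) + H + 2 * c + 1 ≤ Γ := by
    refine le_trans ?_ hΓ
    have h1 : mx D * (t₃ - t₁) ≤ mx D * (b - a) := by gcongr
    have h2 := Nat.mul_le_mul_left (4 * Fintype.card S * stabConst (Fintype.card S)) h1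
    linarith
  have hΓ' : 2 * (mx D * (b - a)) + 2 * c < Γ := by omega
  have tr₁₂ : ∀ {s j}, T.Near ρ c t₁ s j → T.Near ρ c t₂ s j ∧
      T.val t₂ s = T.val t₁ s + (T.val t₂ (ρ j t₂) - T.val t₁ (ρ j t₁)) := fun {s j} h => by
    obtain ⟨h1, h2⟩ := near_of_code_eq (hcode₁₂ s j) h
    exact ⟨h1, by omega⟩
  have tr₂₃ : ∀ {s j}, T.Near ρ c t₂ s j → T.Near ρ c t₃ s j ∧
      T.val t₃ s = T.val t₂ s + (T.val t₃ (ρ j t₃) - T.val t₂ (ρ j t₂)) := fun {s j} h => by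
    obtain ⟨h1, h2⟩ := near_of_code_eq (hcode₂₃ s j) h
    exact ⟨h1, by omega⟩
  have tr₂₁ : ∀ {s j}, T.Near ρ c t₂ s j → T.Near ρ c t₁ s j := fun {s j} h =>
    (near_of_code_eq (hcode₁₂ s j).symm h).1
  have tr₃₂ : ∀ {s j}, T.Near ρ c t₃ s j → T.Near ρ c t₂ s j := fun {s j} h =>
    (near_of_code_eq (hcode₂₃ s j).symm h).1
  have fin₂ : ∀ s, T.fin t₂ s ↔ T.fin t₁ s := fun s =>
    ⟨fun h => (hcov₂ s h).elim fun j hj => (tr₂₁ hj).1,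
      fun h => (hcov₁ s h).elim fun j hj => (tr₁₂ hj).1.1⟩
  have fin₃ : ∀ s, T.fin t₃ s ↔ T.fin t₁ s := fun s =>
    ⟨fun h => (hcov₃ s h).elim fun j hj => (tr₂₁ (tr₃₂ hj)).1,
      fun h => (hcov₁ s h).elim fun j hj => (tr₂₃ (tr₁₂ hj).1).1.1⟩
  -- sorting the runs
  set w : ι → ℤ := fun j => T.val t₁ (ρ j t₁) with hw
  set e := (Fintype.equivFin ι).symm
  set o : Fin (Fintype.card ι) → ι := fun k => e (Tuple.sort (w ∘ e) k) with ho
  have hoinj : Function.Injective o := fun x y h =>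
    (Tuple.sort (w ∘ e)).injective (e.injective h)
  have hosurj : Function.Surjective o := fun j =>
    ⟨(Tuple.sort (w ∘ e)).symm (e.symm j), by simp [ho]⟩
  have hmono : Monotone (w ∘ o) := Tuple.monotone_sort (w ∘ e)
  have hord : ∀ x y, x < y → ∀ t, a ≤ t → t ≤ b →
      T.val t (ρ (o x) t) + Γ ≤ T.val t (ρ (o y) t) := by
    intro x y hxy t h1 h2
    refine order_transfer hrun hgap hΓ' hat (by omega) h1 h2 ?_
    have h3 : T.val t₁ (ρ (o x) t₁) ≤ T.val t₁ (ρ (o y) t₁) := hmono hxy.le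
    rcases le_abs.1 (hgap (o x) (o y) (fun h => hxy.ne (hoinj h)) t₁ hat (by omega)) with h4 | h4 <;>
      omega
  have hfar : ∀ x y, x < y → ∀ t, a ≤ t → t ≤ b → ∀ s s', T.Near ρ c t s (o x) →
      T.Near ρ c t s' (o y) → T.val t s +
        (4 * Fintype.card S * stabConst (Fintype.card S) * (mx D * (t₃ - t₁)) + H : ℕ) <
          T.val t s' := by
    intro x y hxy t h1 h2 s s' hs hs'
    have h3 := hord x y hxy t h1 h2
    have h4 := abs_le.1 hs.2
    have h5 := abs_le.1 hs'.2
    omega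
  have hsplit : ∀ x y s, x < y → T.Near ρ c t₁ s (o x) → ¬ T.Near ρ c t₁ s (o y) := by
    intro x y s hxy h1 h2
    have := hfar x y hxy t₁ hat (by omega) s s h1 h2
    omega
  refine ⟨lt₁₂, lt₂₃, fun t h1 h2 => hdep t (by omega) (by omega), ?_,
    (Nat.mul_le_mul_left _ (by omega)).trans hlen, fin₂, fin₃,
    ⟨Fintype.card ι, fun k => {s | T.Near ρ c t₁ s (o k)}, fun k => ?_, fun x y hxy => ?_, ?_,
      fun x y hxy s hs s' hs' t ht => ?_, fun k => ?_⟩, low₁₂, low₂₃, ?_⟩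
  · obtain ⟨t, h1, h2, h3⟩ := hdep'
    exact ⟨t, h1, h2, le_antisymm (hdep t (by omega) (by omega)) h3⟩
  · exact ⟨ρ (o k) t₁, (hrun (o k)).1 t₁ hat (by omega), by simp⟩
  · refine Set.disjoint_left.2 fun s hs hs' => ?_
    rcases lt_or_gt_of_ne hxy with h | h
    · exact hsplit x y s h hs hs'
    · exact hsplit y x s h hs' hs
  · ext s
    simp only [Set.mem_iUnion, Set.mem_ofPred_eq]
    refine ⟨fun ⟨k, hk⟩ => hk.1, fun h => ?_⟩
    obtain ⟨j, hj⟩ := hcov₁ s h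
    obtain ⟨k, rfl⟩ := hosurj j
    exact ⟨k, hj⟩
  · have hlt : x < y := by
      rw [Fin.lt_def]
      omega
    simp only [List.mem_cons, List.not_mem_nil, or_false] at ht
    rcases ht with rfl | rfl | rfl
    · exact hfar x y hlt _ hat (by omega) s s' hs hs'
    · exact hfar x y hlt _ (by omega) (by omega) s s' (tr₁₂ hs).1 (tr₁₂ hs').1
    · exact hfar x y hlt _ (by omega) (by omega) s s' (tr₂₃ (tr₁₂ hs).1).1 (tr₂₃ (tr₁₂ hs').1).1
  · refine ⟨_, _, ?_, fun s hs => ⟨(tr₁₂ hs).2, (tr₂₃ (tr₁₂ hs).1).2⟩⟩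
    rw [Int.sign_eq_sign, Int.sign_eq_sign, hsign]
  -- One run covers the lowest states at all three positions, so the minimum moves exactly as this
  -- run does, and equal signs of its drifts give the equivalence.
  · obtain ⟨s₁, hs₁, hl₁⟩ := T.exists_low t₁ (by omega)
    obtain ⟨s₂, hs₂, hl₂⟩ := T.exists_low t₂ (by omega)
    obtain ⟨s₃, hs₃, hl₃⟩ := T.exists_low t₃ (by omega)
    obtain ⟨j, hj₁⟩ := hcov₁ s₁ hs₁
    have hj₂ := near_lowest hrun hgap hΓ' hbn hat (by omega) (by omega) (by omega) hcov₂ hj₁ hl₁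
      hs₂ hl₂
    have hj₃ := near_lowest hrun hgap hΓ' hbn hat (by omega) (by omega) (by omega) hcov₃ hj₁ hl₁
      hs₃ hl₃
    have e₁ : T.low t₂ = T.low t₁ + (T.val t₂ (ρ j t₂) - T.val t₁ (ρ j t₁)) := by
      have h1 := (tr₁₂ hj₁).2
      have h2 := (tr₁₂ (tr₂₁ hj₂)).2
      have h3 := T.low_le t₂ (by omega) s₁ (tr₁₂ hj₁).1.1
      have h4 := T.low_le t₁ (by omega) s₂ (tr₂₁ hj₂).1
      omega
    have e₂ : T.low t₃ = T.low t₂ + (T.val t₃ (ρ j t₃) - T.val t₂ (ρ j t₂)) := by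
      have h1 := (tr₂₃ hj₂).2
      have h2 := (tr₂₃ (tr₃₂ hj₃)).2
      have h3 := T.low_le t₃ (by omega) s₂ (tr₂₃ hj₂).1.1
      have h4 := T.low_le t₂ (by omega) s₃ (tr₃₂ hj₃).1
      omega
    have hz : T.val t₂ (ρ j t₂) - T.val t₁ (ρ j t₁) = 0 ↔
        T.val t₃ (ρ j t₃) - T.val t₂ (ρ j t₂) = 0 := by
      rw [← sign_eq_zero_iff, hsign j, sign_eq_zero_iff]
    omega

end Separated

end ConfigSeq

-- Existence of a separated repeating infix.

namespace ConfigSeq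

variable {S : Type u} [Fintype S] {n W H i₀ : ℕ}
  {T : ConfigSeq S n H (maxF (Fintype.card S) W H i₀)}

omit [Fintype S] in
theorem lenF_antitone {N : ℕ} (hN : 1 ≤ N) (d : ℕ) {i j : ℕ} (hij : i ≤ j) :
    lenF N W H i₀ (d + 1) j ≤ lenF N W H i₀ (d + 1) i := by
  induction j, hij using Nat.le_induction with
  | base => exact le_rfl
  | succ j _ ih => exact (lenF_succ_le hN d j).trans ih

/-- If every position of a block is good or lies below an earlier one, then a separated repeating
infix is found among the good positions. -/
theorem exists_isSepRep_of_dichotomy (hN : 1 ≤ Fintype.card S) {ι : Type} [Fintype ι]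
    {ρ : ι → ℕ → S} {D a b e : ℕ} (hι1 : 1 ≤ Fintype.card ι)
    (hιN : Fintype.card ι ≤ Fintype.card S)
    (hab : a + blockLen (Fintype.card S) W H i₀ D (Fintype.card ι) = b) (hbn : b ≤ n)
    (hdep : ∀ t, a ≤ t → t < b → T.dep t ≤ D) (hlow : T.low a ≤ T.low b)
    (hrun : ∀ j, T.IsRun D (ρ j) a b)
    (hgap : ∀ j k, j ≠ k → ∀ t, a ≤ t → t ≤ b →
      (runGap (Fintype.card S) W H i₀ D (Fintype.card ι) : ℤ) ≤
        |T.val t (ρ j t) - T.val t (ρ k t)|)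
    (he : 1 ≤ e) (heΛ : e ≤ lenF (Fintype.card S) W H i₀ D 1)
    (hgood : ∀ t, a + lenF (Fintype.card S) W H i₀ D 1 *
        lenF (Fintype.card S) W H i₀ (D + 1) (Fintype.card ι + 1) ≤ t → t ≤ b →
      ((∀ s, T.fin t s →
          ∃ j, T.Near ρ (covF (Fintype.card S) W H i₀ (D + 1) (Fintype.card ι)) t s j) ∧
        ∃ t', t - e ≤ t' ∧ t' < t ∧ D ≤ T.dep t') ∨
      ∃ l, 1 ≤ l ∧ l ≤ lenF (Fintype.card S) W H i₀ D 1 *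
        lenF (Fintype.card S) W H i₀ (D + 1) (Fintype.card ι + 1) ∧ T.low t < T.low (t - l)) :
    ∃ t₁ t₂ t₃, a ≤ t₁ ∧ t₃ ≤ b ∧
      T.IsSepRep (fun d => lenF (Fintype.card S) W H i₀ d 1) D t₁ t₂ t₃ := by
  set i := Fintype.card ι with hi
  set c := covF (Fintype.card S) W H i₀ (D + 1) i with hc
  have hlen := length_le_blockLen (W := W) (H := H) (i₀ := i₀) hN hιN heΛ rfl rfl rfl
  obtain ⟨q, hq, hqq⟩ := exists_sequence
    (δ := H + maxF (Fintype.card S) W H i₀ D)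
    (R := Ramsey (typF (Fintype.card S) W H i₀ (D + 1) i) 3) he rfl hlow (fun t h1 h2 => by
    refine (T.rise t (by omega)).trans (by
      have := maxF_mono (W := W) (H := H) (i₀ := i₀) hN (hdep t h1 h2)
      omega)) hgood (by rw [add_assoc]; omega)
  classical
  -- A colour consists of a sign for each run and a code for each state and run at both ends of the
  -- pair. The two ends account for the factor 2 in the exponent of `typF`.
  have hcard : Fintype.card ((ι → SignType) × (Bool × S × ι → Fin (2 * c + 2))) =
      typF (Fintype.card S) W H i₀ (D + 1) i := by
    rw [typF, ← hc]
    simp only [Fintype.card_prod, Fintype.card_fun, Fintype.card_bool, Fintype.card_fin, ← hi,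
      mul_assoc]
    rfl
  obtain ⟨x, y, z, hxy, hyz, hcol⟩ := exists_ramsey_triple hcard fun x y =>
    (fun j => SignType.sign (T.val (q y) (ρ j (q y)) - T.val (q x) (ρ j (q x))),
      fun p => T.code ρ c (q (bif p.1 then x else y)) p.2.1 p.2.2)
  rw [Prod.mk.injEq] at hcol
  obtain ⟨hax, hbx, hcx, hdx⟩ := hq x
  obtain ⟨hay, hby, hcy, t', ht1, ht2, ht3⟩ := hq y
  obtain ⟨haz, hbz, hcz, hdz⟩ := hq z
  obtain ⟨hxy1, hxy2⟩ := hqq x y hxy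
  obtain ⟨hyz1, hyz2⟩ := hqq y z hyz
  -- Equal colours of the pairs `x, y` and `y, z` identify the codes at `x` and `y` via the left
  -- ends, and those at `y` and `z` via the right ends.
  refine ⟨q x, q y, q z, hax, hbz, isSepRep_of_code_eq hrun hgap ?_ hbn hax (by omega) (by omega)
    hbz hdep ⟨t', by omega, ht2, ht3⟩ ?_ hxy2 hyz2 ?_
    (fun s j => congrFun hcol.2 (true, s, j)) (fun s j => congrFun hcol.2 (false, s, j))
    fun j => congrFun hcol.1 j⟩
  · rw [show b - a = blockLen (Fintype.card S) W H i₀ D i by omega]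
    exact le_rfl
  · rw [show b - a = blockLen (Fintype.card S) W H i₀ D i by omega]
    refine le_trans ?_ (lenF_antitone hN D hι1)
    rw [lenF_succ hιN]
    gcongr
    nlinarith [stabConst_pos hN]
  · simp only [List.mem_cons, List.not_mem_nil, or_false, forall_eq_or_imp, forall_eq]
    exact ⟨hcx, hcy, hcz⟩

/-- Here `k` counts the runs missing from the maximum. With as many separated runs as states, every
state lies on a run. With fewer, an uncovered state yields a further run on a shorter block, and
either the induction applies there or the minimum has dropped over that block. -/
theorem exists_isSepRep_of_runs (hN : 1 ≤ Fintype.card S) {D a₀ b₀ e : ℕ} (hbn : b₀ ≤ n)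
    (hdep : ∀ t, a₀ ≤ t → t < b₀ → T.dep t ≤ D)
    (he : 1 ≤ e) (heΛ : e ≤ lenF (Fintype.card S) W H i₀ D 1)
    (hB : ∀ t, a₀ + e ≤ t → t ≤ b₀ →
      (∃ t', t - e ≤ t' ∧ t' < t ∧ D ≤ T.dep t') ∨ T.low t < T.low (t - e)) (k : ℕ) :
    ∀ {ι : Type} [Fintype ι] (ρ : ι → ℕ → S), Fintype.card ι + k = Fintype.card S →
      1 ≤ Fintype.card ι → ∀ a b, a₀ ≤ a → b ≤ b₀ →
      a + blockLen (Fintype.card S) W H i₀ D (Fintype.card ι) = b → T.low a ≤ T.low b →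
      (∀ j, T.IsRun D (ρ j) a b) →
      (∀ j k, j ≠ k → ∀ t, a ≤ t → t ≤ b →
        (runGap (Fintype.card S) W H i₀ D (Fintype.card ι) : ℤ) ≤
          |T.val t (ρ j t) - T.val t (ρ k t)|) →
      ∃ t₁ t₂ t₃ D', a₀ ≤ t₁ ∧ t₃ ≤ b₀ ∧
        T.IsSepRep (fun d => lenF (Fintype.card S) W H i₀ d 1) D' t₁ t₂ t₃ := by
  induction k with
  | zero =>
    intro ι _ ρ hι hι1 a b haa hbb hab hlow hrun hgap
    have hL' := Nat.le_mul_of_pos_right (lenF (Fintype.card S) W H i₀ D 1)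
      (lenF_pos (W := W) (H := H) (i₀ := i₀) hN (D + 1) (Fintype.card ι + 1))
    have hcard := hι
    rw [add_zero] at hcard
    obtain ⟨t₁, t₂, t₃, h1, h2, h3⟩ := exists_isSepRep_of_dichotomy hN hι1 hcard.le hab
      (hbb.trans hbn) (fun t h1 h2 => hdep t (by omega) (by omega)) hlow hrun hgap he heΛ
      (fun t h1 h2 => by
        rcases hB t (by omega) (by omega) with h | h
        · refine Or.inl ⟨fun s hs => ?_, h⟩
          have hinj : Function.Injective fun j => ρ j t := fun j k hjk => by
            by_contra hne
            have h3 := hgap j k hne t (by omega) h2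
            simp only at hjk
            have h4 : 0 < runGap (Fintype.card S) W H i₀ D (Fintype.card ι) := Nat.succ_pos _
            rw [hjk, sub_self, abs_zero] at h3
            omega
          obtain ⟨j, hj⟩ := ((Fintype.bijective_iff_injective_and_card _).2
            ⟨hinj, hcard⟩).2 s
          exact ⟨j, hs, by simp [← hj]⟩
        · exact Or.inr ⟨e, he, by omega, h⟩)
    exact ⟨t₁, t₂, t₃, D, by omega, by omega, h3⟩
  | succ k ih =>
    intro ι _ ρ hι hι1 a b haa hbb hab hlow hrun hgap
    by_contra hno
    have hL' := Nat.le_mul_of_pos_right (lenF (Fintype.card S) W H i₀ D 1)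
      (lenF_pos (W := W) (H := H) (i₀ := i₀) hN (D + 1) (Fintype.card ι + 1))
    have hlt : Fintype.card ι < Fintype.card S := by omega
    have hblk := blockLen_succ_le (W := W) (H := H) (i₀ := i₀) (d := D) hN hlt
    have hΓ := runGap_succ_add_le (W := W) (H := H) (i₀ := i₀) (d := D) hN hlt
    have hΓ' := runGap_succ_le (W := W) (H := H) (i₀ := i₀) (d := D) hN hlt
    have hmx := maxF_mono (W := W) (H := H) (i₀ := i₀) hN
    have hblk1 := blockLen_pos (W := W) (H := H) (i₀ := i₀) hN D (Fintype.card ι + 1)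
    refine hno ?_
    obtain ⟨t₁, t₂, t₃, h1, h2, h3⟩ := exists_isSepRep_of_dichotomy hN hι1 hlt.le hab
      (hbb.trans hbn) (fun t h1 h2 => hdep t (by omega) (by omega)) hlow hrun hgap he heΛ
      (fun t h1 h2 => by
        by_cases hcov : ∀ s, T.fin t s →
          ∃ j, T.Near ρ (covF (Fintype.card S) W H i₀ (D + 1) (Fintype.card ι)) t s j
        · rcases hB t (by omega) (by omega) with h | h
          · exact Or.inl ⟨hcov, h⟩
          · exact Or.inr ⟨e, he, by omega, h⟩
        · push Not at hcov
          obtain ⟨s, hs, hfar⟩ := hcov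
          -- The look-back distance is the block length for one more run. If the minimum did not
          -- drop over it, that block would satisfy the induction hypothesis.
          refine Or.inr ⟨_, hblk1, hblk, ?_⟩
          by_contra hle
          set l := blockLen (Fintype.card S) W H i₀ D (Fintype.card ι + 1) with hl
          obtain ⟨ρ', hρ', hrun'⟩ := T.exists_run hmx (show t - l ≤ t by omega) (by omega)
            (fun τ h3 h4 => hdep τ (by omega) (by omega)) hs
          have hnew : ∀ j τ, t - l ≤ τ → τ ≤ t →
              (runGap (Fintype.card S) W H i₀ D (Fintype.card ι + 1) : ℤ) ≤
                |T.val τ (ρ' τ) - T.val τ (ρ j τ)| := by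
            intro j τ h3 h4
            have h5 := hrun'.abs_sub_le_length h3 h4 (by omega) le_rfl
            have h6 := ((hrun j).mono (show a ≤ t - l by omega) h2).abs_sub_le_length h3 h4
              (by omega) le_rfl
            rw [show t - (t - l) = l by omega, abs_le] at h5 h6
            rw [hρ'] at h5
            have h7 : (covF (Fintype.card S) W H i₀ (D + 1) (Fintype.card ι) : ℤ) <
                |T.val t s - T.val t (ρ j t)| := by
              by_contra h
              exact hfar j ⟨hs, not_lt.1 h⟩
            rw [mul_assoc] at hΓ
            rcases lt_abs.1 h7 with h8 | h8
            · refine le_trans ?_ (le_abs_self _)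
              omega
            · refine le_trans ?_ (neg_le_abs _)
              omega
          -- The index `none` is the run traced back from the uncovered state.
          refine hno (ih (ι := Option ι) (fun j => j.elim ρ' ρ) (by
            rw [Fintype.card_option]; omega) (by rw [Fintype.card_option]; omega) (t - l) t
            (by omega) (by omega) (by rw [Fintype.card_option]; omega) (not_lt.1 hle) ?_ ?_)
          · rintro (_ | j)
            · exact hrun'
            · exact (hrun j).mono (by omega) h2
          · rw [Fintype.card_option]
            rintro (_ | j) (_ | j') hjj τ h3 h4
            · exact absurd rfl hjj
            · exact hnew j' τ h3 h4
            · rw [abs_sub_comm]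
              exact hnew j τ h3 h4
            · refine le_trans (by exact_mod_cast hΓ') (hgap j j' (fun h => hjj (h ▸ rfl)) τ
                (by omega) (by omega)))
    exact ⟨t₁, t₂, t₃, D, by omega, by omega, h3⟩

/-- A block whose minimal weight does not decrease contains a separated repeating infix. -/
theorem exists_isSepRep (hN : 1 ≤ Fintype.card S) (D : ℕ) :
    ∀ a b, a + blockLen (Fintype.card S) W H i₀ D 1 = b → b ≤ n →
      (∀ t, a ≤ t → t < b → T.dep t ≤ D) → T.low a ≤ T.low b →
      ∃ t₁ t₂ t₃ D', a ≤ t₁ ∧ t₃ ≤ b ∧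
        T.IsSepRep (fun d => lenF (Fintype.card S) W H i₀ d 1) D' t₁ t₂ t₃ := by
  have main : ∀ D a b e, a + blockLen (Fintype.card S) W H i₀ D 1 = b → b ≤ n →
      (∀ t, a ≤ t → t < b → T.dep t ≤ D) → T.low a ≤ T.low b → 1 ≤ e →
      e ≤ lenF (Fintype.card S) W H i₀ D 1 →
      (∀ t, a + e ≤ t → t ≤ b →
        (∃ t', t - e ≤ t' ∧ t' < t ∧ D ≤ T.dep t') ∨ T.low t < T.low (t - e)) →
      ∃ t₁ t₂ t₃ D', a ≤ t₁ ∧ t₃ ≤ b ∧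
        T.IsSepRep (fun d => lenF (Fintype.card S) W H i₀ d 1) D' t₁ t₂ t₃ := by
    intro D a b e hab hbn hdep hlow he heΛ hB
    obtain ⟨s, hs, -⟩ := T.exists_low b hbn
    obtain ⟨ρ, -, hρ⟩ := T.exists_run (maxF_mono hN) (show a ≤ b by omega) hbn hdep hs
    exact exists_isSepRep_of_runs hN hbn hdep he heΛ hB (Fintype.card S - 1) (ι := Unit)
      (fun _ => ρ) (by rw [Fintype.card_unit]; omega) (by simp) a b le_rfl le_rfl (by simpa using hab)
      hlow (fun _ => hρ) fun j k hjk => absurd (Subsingleton.elim j k) hjk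
  induction D with
  | zero =>
    intro a b hab hbn hdep hlow
    exact main 0 a b 1 hab hbn hdep hlow le_rfl (by simp [lenF]) fun t h1 h2 =>
      Or.inl ⟨t - 1, le_rfl, by omega, Nat.zero_le _⟩
  | succ D ih =>
    intro a b hab hbn hdep hlow
    by_contra hno
    have hpos := blockLen_pos (W := W) (H := H) (i₀ := i₀) hN D 1
    -- The window is a whole block of depth `D`: without a letter of depth `D + 1` in it, the
    -- induction hypothesis applies unless the minimum drops.
    refine hno (main (D + 1) a b _ hab hbn hdep hlow hpos
      (blockLen_le_lenF hN hN D) fun t h1 h2 => ?_)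
    by_contra hneg
    push Not at hneg
    obtain ⟨h3, h4⟩ := hneg
    obtain ⟨t₁, t₂, t₃, D', h5, h6, h7⟩ := ih (t - blockLen (Fintype.card S) W H i₀ D 1) t
      (by omega) (by omega) (fun τ h5 h6 => Nat.le_of_lt_succ (h3 τ h5 h6)) h4
    exact hno ⟨t₁, t₂, t₃, D', by omega, by omega, h7⟩

end ConfigSeq

-- Weight bounds for bounded letters.

section Weights

variable {Q : Type u} {Sig : Type v} [DecidableEq Q] [Fintype Q] {A : WFA Q Sig}

theorem abs_le_maxWt {σ : Letter Q Sig} {s r : State Q} {v : ℤ} (h : letterWt A σ s r = v) :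
    |v| ≤ maxWt A σ := by
  have h1 : ((letterWt A σ s r).untopD 0).natAbs ≤ maxWt A σ :=
    (Finset.le_sup (f := fun r => ((letterWt A σ s r).untopD 0).natAbs) (mem_univ r)).trans
      (Finset.le_sup (f := fun s => univ.sup fun r => ((letterWt A σ s r).untopD 0).natAbs)
        (mem_univ s))
  rw [h, WithTop.untopD_coe] at h1
  rw [Int.abs_eq_natAbs]
  exact_mod_cast h1

omit [DecidableEq Q] [Fintype Q] in
theorem exists_coe_add {a b : WithTop ℤ} {v : ℤ} (h : a + b = v) :
    ∃ x y : ℤ, a = x ∧ b = y ∧ v = x + y := by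
  obtain ⟨x, y, hx, hy, hxy⟩ := WithTop.add_eq_coe.1 h
  exact ⟨x, y, hx.symm, hy.symm, hxy.symm⟩

theorem abs_mwt_le_maxEff {w : List (Letter Q Sig)} {s r : State Q} {v : ℤ}
    (h : mwt A w s r = v) : |v| ≤ maxEff A w := by
  induction w generalizing s v with
  | nil =>
    simp only [mwt] at h
    split_ifs at h
    · have h0 : (0 : ℤ) = v := WithTop.coe_injective h
      simp [← h0]
    · simp at h
  | cons σ w ih =>
    obtain ⟨t, ht⟩ := mwt_cons A σ w s r
    obtain ⟨x, y, hx, hy, rfl⟩ := exists_coe_add (ht.symm.trans h)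
    have h1 := abs_le_maxWt hx
    have h2 := ih hy
    have h3 : maxEff A (σ :: w) = maxWt A σ + maxEff A w := by simp [maxEff]
    rw [h3]
    push_cast
    exact (abs_add_le x y).trans (add_le_add h1 h2)

theorem abs_mpow_le {M : State Q → State Q → WithTop ℤ} {B : ℕ}
    (hM : ∀ s r (v : ℤ), M s r = v → |v| ≤ B) (n : ℕ) {s r : State Q} {v : ℤ}
    (h : mpow M n s r = v) : |v| ≤ (n * B : ℕ) := by
  induction n generalizing s v with
  | zero =>
    simp only [mpow] at h
    split_ifs at h
    · have h0 : (0 : ℤ) = v := WithTop.coe_injective h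
      simp [← h0]
    · simp at h
  | succ n ih =>
    obtain ⟨t, ht⟩ := exists_mpow_succ M n s r
    obtain ⟨x, y, hx, hy, rfl⟩ := exists_coe_add (ht.symm.trans h)
    have h1 := hM _ _ _ hx
    have h2 := ih hy
    rw [Nat.succ_mul, add_comm (n * B)]
    push_cast at h2 ⊢
    exact (abs_add_le x y).trans (add_le_add h1 h2)

theorem abs_stabWt_le {S' : Finset (State Q)} {M : State Q → State Q → WithTop ℤ} {B : ℕ}
    (hM : ∀ s r (v : ℤ), M s r = v → |v| ≤ B) {s r : State Q} {v : ℤ}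
    (h : stabWt S' M s r = v) :
    |v| ≤ (2 * stabConst (Fintype.card (State Q)) * B : ℕ) := by
  have hg := isGrounded_of_stabWt_ne_top (S' := S') (M := M) (s := s) (r := r) (by rw [h]; simp)
  rw [stabWt, if_pos hg] at h
  obtain ⟨-, -, g, hgm, -⟩ := hg
  obtain ⟨g', -, hg'⟩ := Finset.exists_mem_eq_inf _ ⟨g, hgm⟩ fun g =>
    mpow M (stabConst (Fintype.card (State Q))) s g +
      mpow M (stabConst (Fintype.card (State Q))) g r
  obtain ⟨x, y, hx, hy, rfl⟩ := exists_coe_add (hg'.symm.trans h)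
  have h1 := abs_mpow_le hM _ hx
  have h2 := abs_mpow_le hM _ hy
  rw [mul_assoc, two_mul]
  push_cast at h1 h2 ⊢
  exact (abs_add_le x y).trans (add_le_add h1 h2)

omit [Fintype Q] in
theorem depth_le_iff {w : List (Letter Q Sig)} {d : ℕ} :
    depth w ≤ d ↔ ∀ σ ∈ w, letterDepth σ ≤ d := by
  induction w with
  | nil => simp [depth]
  | cons σ w ih => simp [depth, ih]

theorem maxEff_le {w : List (Letter Q Sig)} {B : ℕ} (h : ∀ σ ∈ w, maxWt A σ ≤ B) :
    maxEff A w ≤ w.length * B := by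
  have := List.sum_le_card_nsmul (w.map (maxWt A)) B (by simpa using h)
  simpa [maxEff] using this

variable (A) in
/-- The bound on the weights of the letters of a given depth. -/
def genMaxWt [Fintype Sig] : ℕ → ℕ :=
  maxF (Fintype.card (State Q)) (stdMaxWt A) (Hconst A) 0

theorem one_le_card_state (A : WFA Q Sig) : 1 ≤ Fintype.card (State Q) :=
  Fintype.card_pos_iff.2 ⟨init A⟩

theorem genMaxWt_mono [Fintype Sig] : Monotone (genMaxWt A) := maxF_mono (one_le_card_state A)

/-- A cactus transition is a run on two `stabConst`-fold powers of its word, whose letters obey the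
bound of smaller depth. This is the recursion of `maxF`, where the length at index 1 is bounded by
that at index 0. -/
theorem maxWt_le [Fintype Sig] {σ : Letter Q Sig} (hσ : IsBdd A (Lgen A) σ) :
    maxWt A σ ≤ genMaxWt A (letterDepth σ) := by
  induction hσ with
  | std p a q =>
    have h1 : genMaxWt A 0 = stdMaxWt A := by rw [genMaxWt, maxF]
    have h2 : ∀ f : Q × Sig × Q → ℕ, f (p, a, q) ≤ univ.sup f := fun f =>
      Finset.le_sup (mem_univ (p, a, q))
    rw [letterDepth, h1, stdMaxWt]
    exact h2 fun t => maxWt A (.std t.1 t.2.1 t.2.2)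
  | cactus S' w hw hst hnd hd hl ih =>
    have hB : maxEff A w ≤ w.length * genMaxWt A (depth w) :=
      maxEff_le fun σ hσ => (ih σ hσ).trans (genMaxWt_mono (depth_le_iff.1 le_rfl σ hσ))
    have hlen : w.length ≤
        lenF (Fintype.card (State Q)) (stdMaxWt A) (Hconst A) 0 (depth w + 1) 0 :=
      hl.trans (lenF_succ_le (one_le_card_state A) _ _)
    have hmax : genMaxWt A (depth w + 1) = 2 * stabConst (Fintype.card (State Q)) *
        genMaxWt A (depth w) *
          lenF (Fintype.card (State Q)) (stdMaxWt A) (Hconst A) 0 (depth w + 1) 0 := by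
      rw [genMaxWt, maxF]
    rw [letterDepth, add_comm, hmax]
    refine Finset.sup_le fun s _ => Finset.sup_le fun r _ => ?_
    rw [letterWt_cactus]
    cases h : stabWt S' (mwt A w) s r with
    | top => simp
    | coe v =>
      have h1 := abs_stabWt_le (fun s r v => abs_mwt_le_maxEff) h
      have h2 : 2 * stabConst (Fintype.card (State Q)) * maxEff A w ≤
          2 * stabConst (Fintype.card (State Q)) * genMaxWt A (depth w) *
            lenF (Fintype.card (State Q)) (stdMaxWt A) (Hconst A) 0 (depth w + 1) 0 := by
        rw [mul_assoc _ (genMaxWt A (depth w))]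
        gcongr
        refine hB.trans ?_
        rw [mul_comm]
        gcongr
      rw [Int.abs_eq_natAbs] at h1
      rw [WithTop.untopD_coe]
      omega

end Weights

-- From words to configuration sequences and back.

section Trace

variable {Q : Type u} {Sig : Type v} [DecidableEq Q] [Fintype Q] [Fintype Sig] {A : WFA Q Sig}

/-- The minimal weight of the configuration reached by a word. -/
def lowest (A : WFA Q Sig) (w : List (Letter Q Sig)) : ℤ := (univ.inf (xconf A w)).untopD 0

omit [Fintype Sig] in
theorem coe_lowest {w : List (Letter Q Sig)} {r : State Q} (hr : xconf A w r ≠ ⊤) :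
    ((lowest A w : ℤ) : WithTop ℤ) = univ.inf (xconf A w) := by
  obtain ⟨v, hv⟩ := WithTop.ne_top_iff_exists.1
    (ne_top_of_le_ne_top hr (Finset.inf_le (mem_univ r)))
  rw [lowest, ← hv, WithTop.untopD_coe]

omit [Fintype Sig] in
theorem lowest_le {w : List (Letter Q Sig)} {r : State Q} {v : ℤ} (hr : xconf A w r = v) :
    lowest A w ≤ v := by
  have h := coe_lowest (A := A) (w := w) (r := r) (by rw [hr]; simp)
  rw [← WithTop.coe_le_coe, h, ← hr]
  exact Finset.inf_le (mem_univ r)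

omit [Fintype Sig] in
theorem exists_eq_lowest {w : List (Letter Q Sig)} {r : State Q} (hr : xconf A w r ≠ ⊤) :
    ∃ s, xconf A w s = ((lowest A w : ℤ) : WithTop ℤ) := by
  obtain ⟨s, -, hs⟩ := Finset.exists_mem_eq_inf univ ⟨r, mem_univ r⟩ (xconf A w)
  exact ⟨s, by rw [coe_lowest hr, hs]⟩

omit [Fintype Sig] in
theorem exists_xconf_take_ne_top {w : List (Letter Q Sig)} {r : State Q} (hr : xconf A w r ≠ ⊤)
    (t : ℕ) : ∃ s, xconf A (w.take t) s ≠ ⊤ := by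
  obtain ⟨s, hs⟩ := exists_mwt_append A (w.take t) (w.drop t) (init A) r
  rw [List.take_append_drop] at hs
  refine ⟨s, fun h => hr ?_⟩
  rw [xconf] at h
  rw [xconf, hs, h, top_add]

/-- Without large potentials, the minimal weight rises by a bounded amount on each letter. -/
theorem lowest_snoc_le
    (hno : ¬ ∃ w : List (Letter Q Sig), (∀ σ ∈ w, IsStd σ) ∧ HasSeamlessBaseline A w ∧
      (((Hconst A : ℤ) : WithTop ℤ) : WithBot (WithTop ℤ)) < potential A w)
    {w : List (Letter Q Sig)} {σ : Letter Q Sig} (hw : ∀ τ ∈ w, IsBdd A (Lgen A) τ)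
    (hσ : IsBdd A (Lgen A) σ) {r : State Q} (hr : xconf A (w ++ [σ]) r ≠ ⊤) :
    lowest A (w ++ [σ]) ≤ lowest A w + (Hconst A + maxWt A σ : ℕ) := by
  obtain ⟨q, t, hd, ht⟩ := exists_isDominant hσ hr
  obtain ⟨vq, hvq⟩ := WithTop.ne_top_iff_exists.1 hd.1
  obtain ⟨x, hx⟩ := WithTop.ne_top_iff_exists.1 ht
  obtain ⟨m, hm⟩ := exists_eq_lowest hd.1
  -- Otherwise the dominant state `q` would yield a standard-letter word whose potential exceeds
  -- `Hconst A`.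
  have h1 : vq - lowest A w ≤ Hconst A := by
    by_contra hlt
    obtain ⟨w', h1, h2, h3⟩ := exists_std_potential_ge hw hd hvq.symm hm
    refine hno ⟨w', h1, h2, lt_of_lt_of_le ?_ h3⟩
    rw [WithBot.coe_lt_coe, WithTop.coe_lt_coe]
    omega
  have h2 := abs_le.1 (abs_le_maxWt hx.symm)
  have h3 := xconf_snoc_le (A := A) w σ q t
  rw [← hvq, ← hx, ← WithTop.coe_add] at h3
  obtain ⟨y, hy⟩ := WithTop.ne_top_iff_exists.1 (ne_top_of_le_ne_top WithTop.coe_ne_top h3)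
  have h4 := lowest_le hy.symm
  rw [← hy, WithTop.coe_le_coe] at h3
  push_cast
  omega

/-- The trace of the configurations along a word. -/
def trace (w : List (Letter Q Sig))
    (hno : ¬ ∃ w : List (Letter Q Sig), (∀ σ ∈ w, IsStd σ) ∧ HasSeamlessBaseline A w ∧
      (((Hconst A : ℤ) : WithTop ℤ) : WithBot (WithTop ℤ)) < potential A w)
    (hw : ∀ τ ∈ w, IsBdd A (Lgen A) τ) (hfin : ∃ r, xconf A w r ≠ ⊤) :
    ConfigSeq (State Q) w.length (Hconst A) (genMaxWt A) where
  fin t s := xconf A (w.take t) s ≠ ⊤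
  val t s := (xconf A (w.take t) s).untopD 0
  dep t := (w[t]?).elim 0 letterDepth
  low t := lowest A (w.take t)
  back t ht r hr := by
    rw [List.take_succ_eq_append_getElem ht] at hr ⊢
    obtain ⟨v, hv⟩ := WithTop.ne_top_iff_exists.1 hr
    obtain ⟨s, hs⟩ := exists_xconf_snoc (A := A) (w.take t) w[t] r
    obtain ⟨x, y, hx, hy, rfl⟩ := exists_coe_add (hs.symm.trans hv.symm)
    refine ⟨s, by rw [hx]; simp, ?_⟩
    rw [← hv, hx, WithTop.untopD_coe, WithTop.untopD_coe, List.getElem?_eq_getElem ht,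
      add_sub_cancel_left]
    refine (abs_le_maxWt hy).trans ?_
    exact_mod_cast maxWt_le (hw _ (List.getElem_mem ht))
  low_le t _ s hs := by
    obtain ⟨v, hv⟩ := WithTop.ne_top_iff_exists.1 hs
    rw [← hv, WithTop.untopD_coe]
    exact lowest_le hv.symm
  exists_low t _ := by
    obtain ⟨r, hr⟩ := hfin
    obtain ⟨s, hs⟩ := exists_xconf_take_ne_top hr t
    obtain ⟨m, hm⟩ := exists_eq_lowest hs
    exact ⟨m, by rw [hm]; simp, by rw [hm, WithTop.untopD_coe]⟩
  rise t ht := by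
    obtain ⟨r, hr⟩ := hfin
    obtain ⟨s, hs⟩ := exists_xconf_take_ne_top hr (t + 1)
    rw [List.take_succ_eq_append_getElem ht] at hs ⊢
    have h := lowest_snoc_le hno (fun τ hτ => hw τ (List.mem_of_mem_take hτ))
      (hw _ (List.getElem_mem ht)) hs
    have h2 := maxWt_le (hw _ (List.getElem_mem ht))
    rw [List.getElem?_eq_getElem ht, Option.elim_some]
    push_cast at h ⊢
    omega

/-- Separated repeating infixes of the trace are separated repeating infixes of the word. -/
theorem isGSRI_of_isSepRep {u x y v : List (Letter Q Sig)}
    (hno : ¬ ∃ w : List (Letter Q Sig), (∀ σ ∈ w, IsStd σ) ∧ HasSeamlessBaseline A w ∧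
      (((Hconst A : ℤ) : WithTop ℤ) : WithBot (WithTop ℤ)) < potential A w)
    (hw : ∀ τ ∈ u ++ x ++ y ++ v, IsBdd A (Lgen A) τ)
    (hfin : ∃ r, xconf A (u ++ x ++ y ++ v) r ≠ ⊤)
    (hseam : HasSeamlessBaseline A (u ++ x ++ y ++ v)) {D : ℕ}
    (h : (trace _ hno hw hfin).IsSepRep (Lgen A) D u.length (u ++ x).length
      (u ++ x ++ y).length) : IsGSRI A u x y v := by
  have take₁ : (u ++ x ++ y ++ v).take u.length = u := by
    rw [List.append_assoc, List.append_assoc]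
    exact List.take_left
  have take₂ : (u ++ x ++ y ++ v).take (u ++ x).length = u ++ x := by
    rw [List.append_assoc]
    exact List.take_left
  have take₃ : (u ++ x ++ y ++ v).take (u ++ x ++ y).length = u ++ x ++ y := List.take_left
  have hl₂ : (u ++ x).length = u.length + x.length := List.length_append
  have hl₃ : (u ++ x ++ y).length = u.length + x.length + y.length := by
    rw [List.length_append, hl₂]
  obtain ⟨lt₁₂, lt₂₃, dep_le, dep_eq, short, fin₂, fin₃, parts, low₁₂, low₂₃, low_iff⟩ := h
  simp only [trace, take₁, take₂, take₃] at dep_le dep_eq fin₂ fin₃ parts low₁₂ low₂₃ low_iff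
  have hdepxy : ∀ σ ∈ x ++ y, letterDepth σ ≤ D := by
    intro σ hσ
    obtain ⟨i, hi, rfl⟩ := List.getElem_of_mem hσ
    have hi' := hi
    rw [List.length_append] at hi'
    have h1 := dep_le (u.length + i) (by omega) (by omega)
    have h2 : (u ++ x ++ y ++ v)[u.length + i]? = some (x ++ y)[i] := by
      rw [List.append_assoc u, List.getElem?_append_left (by simp; omega),
        List.getElem?_append_right (by omega), Nat.add_sub_cancel_left,
        List.getElem?_eq_getElem hi]
    rwa [h2] at h1
  -- The depth is attained inside `x` itself, so the length bound, stated for depth `D + 1`, is the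
  -- one required of `x`.
  have hdepx : depth x = D := by
    refine le_antisymm (depth_le_iff.2 fun σ hσ => hdepxy σ (by simp [hσ])) ?_
    obtain ⟨t, h1, h2, h3⟩ := dep_eq
    have h4 : t - u.length < x.length := by omega
    have h5 : (u ++ x ++ y ++ v)[t]? = some x[t - u.length] := by
      rw [List.append_assoc, List.getElem?_append_left (by omega),
        List.getElem?_append_right h1, List.getElem?_eq_getElem h4]
    rw [h5] at h3
    rw [← h3]
    exact depth_le_iff.1 le_rfl _ (List.getElem_mem h4)
  have heff : maxEff A (x ++ y) ≤ genMaxWt A D * ((u ++ x ++ y).length - u.length) := by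
    have h1 : maxEff A (x ++ y) ≤ (x ++ y).length * genMaxWt A D := maxEff_le fun σ hσ =>
      (maxWt_le (hw σ (by
        simp only [List.mem_append] at hσ ⊢
        tauto))).trans (genMaxWt_mono (hdepxy σ hσ))
    rw [hl₃, mul_comm]
    refine h1.trans (le_of_eq ?_)
    rw [List.length_append]
    congr 1
    omega
  have hcoe : ∀ {w : List (Letter Q Sig)} {s : State Q}, xconf A w s ≠ ⊤ →
      xconf A w s = (((xconf A w s).untopD 0 : ℤ) : WithTop ℤ) := fun {w s} hs => by
    obtain ⟨v, hv⟩ := WithTop.ne_top_iff_exists.1 hs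
    rw [← hv, WithTop.untopD_coe]
  obtain ⟨ℓ, V, hne, hdisj, hunion, hgap, hshift⟩ := parts
  have hV : ∀ j, ∀ s ∈ V j, xconf A u s ≠ ⊤ := fun j s hs => by
    have h1 : s ∈ ⋃ j, V j := Set.mem_iUnion.2 ⟨j, hs⟩
    rw [hunion] at h1
    exact h1
  refine ⟨hw, ?_, ?_, Set.ext fin₂, Set.ext fin₃, ?_,
    ⟨ℓ, V, hne, hdisj, hunion, fun i j hij s hs s' hs' ξ hξ => ?_, fun j => ?_⟩, hseam,
    neg_le_neg low₁₂, neg_le_neg low₂₃, ?_⟩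
  · rintro rfl
    simp at lt₁₂
  · rintro rfl
    simp at lt₂₃
  · rw [hdepx]
    rwa [show (u ++ x).length - u.length = x.length by omega] at short
  · have hfin : xconf A ξ s ≠ ⊤ ∧ xconf A ξ s' ≠ ⊤ ∧ ∃ t, t ∈ [u.length, (u ++ x).length,
        (u ++ x ++ y).length] ∧ (u ++ x ++ y ++ v).take t = ξ := by
      simp only [List.mem_cons, List.not_mem_nil, or_false] at hξ
      rcases hξ with rfl | rfl | rfl
      · exact ⟨hV i s hs, hV j s' hs', _, List.mem_cons_self, take₁⟩
      · exact ⟨(fin₂ s).2 (hV i s hs), (fin₂ s').2 (hV j s' hs'), (u ++ x).length, by simp, take₂⟩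
      · exact ⟨(fin₃ s).2 (hV i s hs), (fin₃ s').2 (hV j s' hs'),
          (u ++ x ++ y).length, by simp, take₃⟩
    obtain ⟨h1, h2, t, ht, rfl⟩ := hfin
    have h3 := hgap i j hij s hs s' hs' t ht
    rw [hcoe h1, hcoe h2, ← WithTop.coe_add, WithTop.coe_lt_coe]
    refine lt_of_le_of_lt ?_ h3
    gcongr
  · obtain ⟨kx, ky, hsign, hk⟩ := hshift j
    refine ⟨kx, ky, hsign, fun s hs => ?_⟩
    obtain ⟨h1, h2⟩ := hk s hs
    rw [hcoe (hV j s hs), hcoe ((fin₂ s).2 (hV j s hs)), hcoe ((fin₃ s).2 (hV j s hs)), h1, h2, h1]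
    exact ⟨rfl, rfl⟩
  · change -lowest A u = -lowest A (u ++ x) ↔ -lowest A (u ++ x) = -lowest A (u ++ x ++ y)
    rw [neg_inj, neg_inj]
    exact low_iff

omit [DecidableEq Q] [Fintype Q] [Fintype Sig] in
theorem exists_split {α : Type*} (w : List α) {k : ℕ} (hk : k ≤ w.length) :
    ∃ p s, w = p ++ s ∧ p.length = k :=
  ⟨w.take k, w.drop k, (List.take_append_drop k w).symm, List.length_take_of_le hk⟩

omit [Fintype Sig] in
theorem letterDepth_lt {L : ℕ → ℕ} {σ : Letter Q Sig} (hσ : IsBdd A L σ) :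
    letterDepth σ < Fintype.card (State Q) := by
  cases hσ with
  | std p a q =>
    rw [letterDepth]
    exact one_le_card_state A
  | cactus S' w _ _ _ hd _ =>
    rw [letterDepth]
    omega

end Trace
end TropWFA
end

theorem mainTheorem10 {Q : Type*} {Sig : Type*} [DecidableEq Q] [Fintype Q] [Fintype Sig]
    (A : TropWFA.WFA Q Sig) :
    (∃ w : List (TropWFA.Letter Q Sig), (∀ σ ∈ w, TropWFA.IsStd σ) ∧
      TropWFA.HasSeamlessBaseline A w ∧
      (((TropWFA.Hconst A : ℤ) : WithTop ℤ) : WithBot (WithTop ℤ)) < TropWFA.potential A w) ∨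
    (∀ w₁ w₂ w₃ : List (TropWFA.Letter Q Sig),
      (∀ σ ∈ w₁ ++ w₂ ++ w₃, TropWFA.IsBdd A (TropWFA.Lgen A) σ) →
      TropWFA.IsChargeDecreasing A w₁ w₂ w₃ →
      32 * TropWFA.stabConst (Fintype.card (TropWFA.State Q)) ^ 2 * w₂.length =
        TropWFA.GLen A (Fintype.card (TropWFA.State Q)) 1 →
      ∃ u x y v p s : List (TropWFA.Letter Q Sig),
        w₁ ++ w₂ ++ w₃ = u ++ x ++ y ++ v ∧
        u = w₁ ++ p ∧ w₂ = p ++ x ++ y ++ s ∧ v = s ++ w₃ ∧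
        TropWFA.IsGSRI A u x y v) := by
  open TropWFA in
  refine or_iff_not_imp_left.2 fun hno w₁ w₂ w₃ hw hcd hlen => ?_
  obtain ⟨hseam, hcharge⟩ := hcd
  have hfin : ∃ r, xconf A (w₁ ++ w₂ ++ w₃) r ≠ ⊤ := by
    obtain ⟨ρ, h0, h1, -, h2⟩ := hseam
    have h3 := h2 _ le_rfl
    rw [List.take_length] at h3
    exact ⟨_, h3 ▸ h1⟩
  have hN := one_le_card_state A
  -- The factor `32 * stabConst N ^ 2` is the one that separates `lenF` from `blockLen`, so `w₂` is
  -- exactly one block of depth `N - 1`, the largest depth of a bounded letter.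
  have hblk : w₂.length =
      blockLen (Fintype.card (State Q)) (stdMaxWt A) (Hconst A) 0 (Fintype.card (State Q) - 1) 1 := by
    obtain ⟨d, hd⟩ : ∃ d, Fintype.card (State Q) = d + 1 := ⟨_, (Nat.sub_add_cancel hN).symm⟩
    have h1 := lenF_succ (W := stdMaxWt A) (H := Hconst A) (i₀ := 0) hN d
    rw [← hd] at h1
    rw [GLen, h1] at hlen
    have h2 := stabConst_pos hN
    rw [show Fintype.card (State Q) - 1 = d by omega]
    exact Nat.eq_of_mul_eq_mul_left (by positivity) hlen
  have take₁ : (w₁ ++ w₂ ++ w₃).take w₁.length = w₁ := by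
    rw [List.append_assoc]
    exact List.take_left
  have take₂ : (w₁ ++ w₂ ++ w₃).take (w₁ ++ w₂).length = w₁ ++ w₂ := List.take_left
  obtain ⟨t₁, t₂, t₃, D, h1, h3, hsep⟩ := ConfigSeq.exists_isSepRep (T := trace _ hno hw hfin) hN
    (Fintype.card (State Q) - 1) w₁.length (w₁ ++ w₂).length
    (by rw [List.length_append, hblk]) (by simp) (fun t _ _ => by
      change ((w₁ ++ w₂ ++ w₃)[t]?).elim 0 letterDepth ≤ _
      cases h : (w₁ ++ w₂ ++ w₃)[t]? with
      | none => exact Nat.zero_le _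
      | some σ =>
        have := letterDepth_lt (hw σ (List.mem_of_getElem? h))
        rw [Option.elim_some]
        omega) (by
      change lowest A _ ≤ lowest A _
      rw [take₁, take₂]
      exact neg_le_neg_iff.1 hcharge)
  have h12 := hsep.lt₁₂
  have h23 := hsep.lt₂₃
  rw [List.length_append] at h3
  obtain ⟨p, r, rfl, hp⟩ := exists_split w₂ (k := t₁ - w₁.length) (by omega)
  rw [List.length_append] at h3
  obtain ⟨x, r, rfl, hx⟩ := exists_split r (k := t₂ - t₁) (by omega)
  rw [List.length_append] at h3
  obtain ⟨y, s, rfl, hy⟩ := exists_split r (k := t₃ - t₂) (by omega)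
  have e : w₁ ++ (p ++ (x ++ (y ++ s))) ++ w₃ = w₁ ++ p ++ x ++ y ++ (s ++ w₃) := by
    simp only [List.append_assoc]
  refine ⟨w₁ ++ p, x, y, s ++ w₃, p, s, e, rfl, by simp only [List.append_assoc], rfl, ?_⟩
  have e₁ : t₁ = (w₁ ++ p).length := by rw [List.length_append]; omega
  have e₂ : t₂ = (w₁ ++ p ++ x).length := by rw [List.length_append, ← e₁]; omega
  have e₃ : t₃ = (w₁ ++ p ++ x ++ y).length := by rw [List.length_append, ← e₂]; omega
  clear take₁ take₂ hcharge hlen hblk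
  revert hw hfin hseam hsep
  rw [e]
  intro hw hseam hfin hsep
  rw [e₁, e₂, e₃] at hsep
  exact isGSRI_of_isSepRep hno hw hfin hseam hsep
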